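/- Let $A$ be a finite alphabet. A \emph{substitution} on $A$ is an endomorphism $\sigma$ of the free monoid $A^*$ such that $\sigma(a)$ begins with $a$ for some letter $a\in A$ and $|\sigma^n(b)|\to\infty$ as $n\to\infty$ for every letter $b\in A$. Its incidence matrix is $M_\sigma=(m_{i,j})_{i,j\in A}$, where $m_{i,j}$ is the number of occurrences of $i$ in $\sigma(j)$; $\sigma$ is \emph{primitive} if some power $M_\sigma^k$, $k\ge 1$, has all its entries strictly positive. It is \emph{proper} if all the words $\sigma(b)$, $b\in A$, start with the same letter and all of them end with the same letter. For a primitive substitution $\sigma$, let $\Omega_\sigma\subset A^{\mathbb Z}$ be the set of two-sided sequences each of whose finite factors occurs in $\sigma^n(b)$ for some $n\ge 0$ and $b\in A$, equipped with the topology induced by the product topology and with the shift $S$, $(Sx)_n=x_{n+1}$. The substitution $\sigma$ is \emph{aperiodic} if $\Omega_\sigma$ is infinite. Let $\sigma$ be a primitive aperiodic substitution on $A$. Then there exists a proper primitive substitution $\xi$ on a finite alphabet $B$ such that: 1. $(\Omega_\sigma,S)$ and $(\Omega_\xi,S)$ are topologically conjugate, i.e. there is a homeomorphism $\phi\colon\Omega_\sigma\to\Omega_\xi$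 with $\phi\circ S=S\circ\phi$; 2. there exists an integer $l\ge 1$ such that the matrices $M_\sigma^l$ and $M_\xi$ have the same eigenvalues, except possibly $0$ and $1$: every complex number $\mu\notin\{0,1\}$ is an eigenvalue of $M_\sigma^l$ if and only if it is an eigenvalue of $M_\xi$. -/

import Mathlib

open SymbolicDynamics.FullShift

namespace Substitutive

/-- The image `σ(b)` of a letter `b` under an endomorphism `σ` of the free monoid, as a list. -/
def letterImage {A : Type*} (σ : Monoid.End (FreeMonoid A)) (b : A) : List A :=
  FreeMonoid.toList (σ (FreeMonoid.of b))

/-- A substitution: an endomorphism `σ` of the free monoid `A*` such that `σ(a)` begins with `a`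
for some letter `a`, and `|σⁿ(b)| → ∞` for every letter `b`. -/
def IsSubstitution {A : Type*} (σ : Monoid.End (FreeMonoid A)) : Prop :=
  (∃ a : A, (letterImage σ a).head? = some a) ∧
    ∀ b : A, Filter.Tendsto (fun n : ℕ => (letterImage (σ ^ n) b).length)
      Filter.atTop Filter.atTop

/-- The incidence matrix `M_σ`: the entry `(i, j)` is the number of occurrences of the letter `i`
in the word `σ(j)`. -/
def incidenceMatrix {A : Type*} [DecidableEq A] (σ : Monoid.End (FreeMonoid A)) :
    Matrix A A ℤ :=
  Matrix.of fun i j => ((letterImage σ j).count i : ℤ)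

/-- `σ` is primitive when its incidence matrix is primitive. -/
def IsPrimitive {A : Type*} [Fintype A] [DecidableEq A] (σ : Monoid.End (FreeMonoid A)) : Prop :=
  (incidenceMatrix σ).IsPrimitive

/-- All the words `σ(b)` start with the same letter. -/
def IsLeftProper {A : Type*} (σ : Monoid.End (FreeMonoid A)) : Prop :=
  ∃ a : A, ∀ b : A, (letterImage σ b).head? = some a

/-- All the words `σ(b)` end with the same letter. -/
def IsRightProper {A : Type*} (σ : Monoid.End (FreeMonoid A)) : Prop :=
  ∃ a : A, ∀ b : A, (letterImage σ b).getLast? = some a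

/-- `σ` is proper when it is both left proper and right proper. -/
def IsProper {A : Type*} (σ : Monoid.End (FreeMonoid A)) : Prop :=
  IsLeftProper σ ∧ IsRightProper σ

/-- The language of `σ`: the words having an occurrence in `σⁿ(b)` for some `n` and some
letter `b`. -/
def language {A : Type*} (σ : Monoid.End (FreeMonoid A)) : Set (List A) :=
  {w | ∃ (n : ℕ) (b : A), w <:+: letterImage (σ ^ n) b}

/-- The factor `x_i x_{i+1} ⋯ x_{i+n-1}` of the two-sided sequence `x`. -/
def factor {A : Type*} (x : ℤ → A) (i : ℤ) (n : ℕ) : List A :=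
  List.ofFn fun k : Fin n => x (i + (k : ℤ))

/-- The subshift `Ω_σ` generated by `σ`: the two-sided sequences all of whose factors belong to
the language of `σ`. -/
def omega {A : Type*} [TopologicalSpace A] [DiscreteTopology A]
    (σ : Monoid.End (FreeMonoid A)) : Subshift A ℤ where
  carrier := {x | ∀ (i : ℤ) (n : ℕ), factor x i n ∈ language σ}
  isClosed := by
    have h : {x : ℤ → A | ∀ (i : ℤ) (n : ℕ), factor x i n ∈ language σ} =
        ⋂ (i : ℤ) (n : ℕ), (fun x : ℤ → A => fun k : Fin n => x (i + (k : ℤ))) ⁻¹'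
          {v | List.ofFn v ∈ language σ} := by
      ext x
      simp [factor]
    rw [h]
    refine isClosed_iInter fun i => isClosed_iInter fun n => ?_
    exact (isClosed_discrete _).preimage (by fun_prop)
  mapsTo := by
    intro g x hx i n
    have h := hx (g + i) n
    simpa [factor, add_assoc] using h

/-- `σ` is aperiodic when `Ω_σ` is not finite. -/
def IsAperiodic {A : Type*} [TopologicalSpace A] [DiscreteTopology A]
    (σ : Monoid.End (FreeMonoid A)) : Prop :=
  (omega σ).carrier.Infinite

/-- The shift transformation `(S x)_n = x_{n+1}`, restricted to a subshift. -/
def shiftMap {A : Type*} [TopologicalSpace A] (X : Subshift A ℤ) (x : X.carrier) : X.carrier :=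
  ⟨shift 1 x.1, X.mapsTo 1 x.2⟩

/-- Two subshifts are (topologically) conjugate when there is a homeomorphism between them which
commutes with the shift transformations. -/
def Conjugate {A B : Type*} [TopologicalSpace A] [TopologicalSpace B]
    (X : Subshift A ℤ) (Y : Subshift B ℤ) : Prop :=
  ∃ φ : X.carrier ≃ₜ Y.carrier, Function.Semiconj φ (shiftMap X) (shiftMap Y)

/-- `μ` is a (complex) eigenvalue of the square integer matrix `M`. -/
def IsEigenvalue {A : Type*} [Fintype A] [DecidableEq A] (M : Matrix A A ℤ) (μ : ℂ) : Prop :=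
  Module.End.HasEigenvalue (Matrix.toLin' (M.map (Int.cast : ℤ → ℂ))) μ

end Substitutive

/-! Replace `σ` by a power `ρ` whose first-letter map `g` and last-letter map `f` are idempotent,
and choose a two-letter word `r l` of the language such that `ρ r` ends with `r` and `ρ l` begins
with `l`. Cutting at the middle of every occurrence of `r l` splits words into return words, which
are finitely many by primitivity. Since `ρ` sends cuts to cuts, it induces a substitution `τ` on
return words. Each return word begins with `l` and ends with `r`, and every image of a letter
contains a cut, so `τ` is proper; if the power is large, every return word occurs in every `τ w`.

To recover the whole subshift, put over each return word `w` a tower of letters `(w, j)`, `j < |w|`.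
Split `τ w` into `|w|` nonempty consecutive parts and let `ξ` send `(w, j)` to the towers over `τ`
of the `j`-th part; the additional `τ` makes `ξ` proper with positive matrix. Projecting `(w, j)` to
the `j`-th letter of `w` is a conjugacy (`conjugate_towerSubst`), because occurrences of `r l` in
the projected sequence show where towers start. The matrices of `ξ` and `τ²` are products `X Y` and
`Y X`, so they share their nonzero eigenvalues (`hasEig_towerSubst`).

It remains to compare `ρ` with `τ` outside `0` and `1`. In one direction
(`IsSetup.hasEig_of_derived`), the piece counts of `ρ(w)` are linear in the counts of adjacent pairs
of `w l`, so nonzero eigenvalues of `τ` are eigenvalues of the action of `ρ` on pairs. That action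
projects onto `ρ`, and on the kernel of the projection it is given by the idempotent `(a, c) ↦ (f a,
g c)`, which adds only `0` and `1`. In the other direction (`IsSetup.hasEig_derived`), the letter
counts of `ρ³(b)` and `ρ²(b)` differ by a combination of those of return words, so a left
eigenvector vanishing on return words has `μ²(μ - 1) = 0`. -/

namespace Substitutive

/-! ### Cutting words at the occurrences of `r l` -/

/-- The boolean relation "`a b` is not the word `r l`". -/
def noCut {A : Type*} [DecidableEq A] (r l a b : A) : Bool := !(decide (a = r) && decide (b = l))

theorem noCut_eq_false {A : Type*} [DecidableEq A] {r l a b : A} :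
    noCut r l a b = false ↔ a = r ∧ b = l := by
  simp [noCut]

theorem noCut_eq_true {A : Type*} [DecidableEq A] {r l a b : A} :
    noCut r l a b = true ↔ ¬ (a = r ∧ b = l) := by
  rw [← noCut_eq_false]; simp

/-- The word `u` cut at the middle of each occurrence of `r l`. -/
def pieces {A : Type*} [DecidableEq A] (r l : A) (u : List A) : List (List A) :=
  u.splitBy (noCut r l)

section Pieces

variable {A : Type*} [DecidableEq A] {r l : A}

theorem flatten_pieces (u : List A) : (pieces r l u).flatten = u := List.flatten_splitBy _ _

theorem ne_nil_of_mem_pieces {u w : List A} (h : w ∈ pieces r l u) : w ≠ [] :=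
  List.ne_nil_of_mem_splitBy h

theorem pieces_append {u v : List A} (hu : u.getLast? = some r) (hv : v.head? = some l) :
    pieces r l (u ++ v) = pieces r l u ++ pieces r l v := by
  refine List.splitBy_append fun x hx y hy => ?_
  rw [noCut_eq_false]
  rw [hu] at hx
  rw [hv] at hy
  simp_all

theorem pieces_of_isChain {w : List A} (hn : w ≠ []) (h : w.IsChain fun x y => noCut r l x y) :
    pieces r l w = [w] :=
  List.splitBy_of_isChain hn h

theorem isChain_of_mem_pieces {u w : List A} (h : w ∈ pieces r l u) :
    w.IsChain fun x y => noCut r l x y :=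
  List.isChain_of_mem_splitBy h

theorem pieces_of_mem_pieces {u w : List A} (h : w ∈ pieces r l u) : pieces r l w = [w] :=
  pieces_of_isChain (ne_nil_of_mem_pieces h) (isChain_of_mem_pieces h)

theorem pieces_split {u : List A} {s t : List (List A)} (h : pieces r l u = s ++ t)
    (hs : s ≠ []) (ht : t ≠ []) :
    pieces r l s.flatten = s ∧ pieces r l t.flatten = t ∧
      s.flatten.getLast? = some r ∧ t.flatten.head? = some l := by
  obtain ⟨-, h1, h2, h3⟩ := List.splitBy_eq_iff.1 h
  obtain ⟨hc1, hc2, hc3⟩ := List.isChain_append.1 h3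
  have e1 : pieces r l s.flatten = s := List.splitBy_flatten (by grind) (by grind) hc1
  have e2 : pieces r l t.flatten = t := List.splitBy_flatten (by grind) (by grind) hc2
  refine ⟨e1, e2, ?_⟩
  obtain ⟨s', x, rfl⟩ := List.eq_nil_or_concat s |>.resolve_left hs
  obtain ⟨y, t', rfl⟩ := List.exists_cons_of_ne_nil ht
  obtain ⟨ha, hb, hab⟩ := hc3 x (by simp) y (by simp)
  obtain ⟨e3, e4⟩ := noCut_eq_false.1 hab
  constructor
  · rw [List.concat_eq_append, List.flatten_append, List.getLast?_append]
    simp [List.getLast?_eq_getLast_of_ne_nil ha, e3]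
  · rw [List.flatten_cons, List.head?_append]
    simp [List.head?_eq_some_head hb, e4]

/-- Cutting is local: the junction can only affect the last piece of `u` and the first piece of `v`.
-/
theorem pieces_append_of_eq {u v x y : List A} {s t : List (List A)}
    (hu : pieces r l u = s ++ [x]) (hv : pieces r l v = y :: t) :
    pieces r l (u ++ v) = s ++ pieces r l (x ++ y) ++ t := by
  have eu : u = s.flatten ++ x := by
    rw [← flatten_pieces (r := r) (l := l) u, hu]; simp
  have ev : v = y ++ t.flatten := by
    rw [← flatten_pieces (r := r) (l := l) v, hv]; simp
  have hx : x ≠ [] := ne_nil_of_mem_pieces (r := r) (l := l) (u := u) (by simp [hu])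
  have hy : y ≠ [] := ne_nil_of_mem_pieces (r := r) (l := l) (u := v) (by simp [hv])
  have key : pieces r l (x ++ y ++ t.flatten) = pieces r l (x ++ y) ++ t := by
    rcases eq_or_ne t [] with rfl | ht
    · simp
    · obtain ⟨-, h2, h3, h4⟩ := pieces_split (s := [y]) (t := t) hv (by simp) ht
      rw [pieces_append, h2]
      · rw [List.getLast?_append]
        simp at h3
        simp [h3]
      · exact h4
  rw [eu, ev]
  rcases eq_or_ne s [] with rfl | hs
  · simpa using key
  · obtain ⟨h2, -, h3, h4⟩ := pieces_split (s := s) (t := [x]) hu hs (by simp)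
    have : s.flatten ++ x ++ (y ++ t.flatten) = s.flatten ++ (x ++ y ++ t.flatten) := by simp
    rw [this, pieces_append h3, key, h2, List.append_assoc]
    simp at h4
    rw [List.append_assoc, List.head?_append]
    simp [h4]

theorem exists_pieces_eq {u : List A} (h : [r, l] <:+: u) :
    ∃ x m y, pieces r l u = x :: (m ++ [y]) := by
  rcases hp : pieces r l u with _ | ⟨x, t⟩
  · have := flatten_pieces (r := r) (l := l) u
    rw [hp] at this
    simp at this
    subst this
    simp at h
  · rcases List.eq_nil_or_concat t with rfl | ⟨m, y, rfl⟩
    · have h1 := flatten_pieces (r := r) (l := l) u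
      rw [hp] at h1
      simp at h1
      have h2 := isChain_of_mem_pieces (r := r) (l := l) (u := u) (w := x) (by simp [hp])
      rw [h1] at h2
      have h3 := h2.infix h
      simp [noCut] at h3
    · exact ⟨x, m, y, by simp⟩

/-- The surrounding letters `r` and `l` force a cut on each side of `w`, and there is none inside.
-/
theorem mem_pieces_of_infix {w u : List A} (hn : w ≠ []) (hh : w.head? = some l)
    (hr : w.getLast? = some r) (hc : w.IsChain fun x y => noCut r l x y)
    (h : r :: (w ++ [l]) <:+: u) : w ∈ pieces r l u := by
  obtain ⟨X, Y, rfl⟩ := h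
  have : X ++ r :: (w ++ [l]) ++ Y = (X ++ [r]) ++ (w ++ (l :: Y)) := by simp
  rw [this, pieces_append (by simp) (by rw [List.head?_append]; simp [hh]),
    pieces_append hr (by simp), pieces_of_isChain hn hc]
  simp

end Pieces

/-! ### Pairs of adjacent letters -/

/-- The successive pairs of adjacent letters of the word `u c`. -/
def pairs {A : Type*} : List A → A → List (A × A)
  | [], _ => []
  | a :: u, c => (a, u.headD c) :: pairs u c

section Pairs

variable {A : Type*}

theorem map_fst_pairs (u : List A) (c : A) : (pairs u c).map Prod.fst = u := by
  induction u with
  | nil => rfl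
  | cons a u ih => simp [pairs, ih]

theorem pairs_append (u v : List A) (c : A) :
    pairs (u ++ v) c = pairs u (v.headD c) ++ pairs v c := by
  induction u with
  | nil => rfl
  | cons a u ih =>
    simp only [List.cons_append, pairs, ih]
    cases u <;> simp

theorem headD_flatMap {ρ : A → List A} {g : A → A} (hg : ∀ b, (ρ b).head? = some (g b))
    (u : List A) (c : A) : (u.flatMap ρ).headD (g c) = g (u.headD c) := by
  cases u with
  | nil => simp
  | cons a u =>
    have := hg a
    rw [List.head?_eq_some_iff] at this
    obtain ⟨z, hz⟩ := this
    simp [hz]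

/-- The letter after `ρ a` is the first letter of the next image, so it depends only on the letter
after `a`: thus `ρ` acts on pairs. -/
theorem pairs_flatMap {ρ : A → List A} {g : A → A} (hg : ∀ b, (ρ b).head? = some (g b))
    (u : List A) (c : A) :
    pairs (u.flatMap ρ) (g c) = (pairs u c).flatMap fun p => pairs (ρ p.1) (g p.2) := by
  induction u with
  | nil => rfl
  | cons a u ih => simp [pairs, pairs_append, ih, headD_flatMap hg, -List.headD_eq_head?_getD]

theorem pairs_flatten {l : A} (ws : List (List A)) (h : ∀ w ∈ ws, w.head? = some l) :
    pairs ws.flatten l = ws.flatMap fun w => pairs w l := by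
  induction ws with
  | nil => rfl
  | cons w ws ih =>
    have h' : ∀ w ∈ ws, w.head? = some l := fun w hw => h w (by simp [hw])
    have : ws.flatten.headD l = l := by
      cases ws with
      | nil => rfl
      | cons v ws =>
        have := h' v (by simp)
        rw [List.head?_eq_some_iff] at this
        obtain ⟨z, hz⟩ := this
        simp [hz]
    rw [List.flatten_cons, pairs_append, this, ih h', List.flatMap_cons]

/-- The pieces of an image word, computed from the pairs of adjacent letters. -/
theorem pieces_flatMap_append [DecidableEq A] {r l : A} {ρ : A → List A} {x y : A → List A}
    {m : A → List (List A)} (h : ∀ a, pieces r l (ρ a) = x a :: (m a ++ [y a]))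
    (u : List A) (c : A) :
    pieces r l (u.flatMap ρ ++ x c) = x (u.headD c) ::
      (pairs u c).flatMap fun p => m p.1 ++ pieces r l (y p.1 ++ x p.2) := by
  induction u with
  | nil => simpa [pairs] using pieces_of_mem_pieces (r := r) (l := l) (u := ρ c) (by simp [h])
  | cons a u ih =>
    rw [List.flatMap_cons, List.append_assoc,
      pieces_append_of_eq (s := x a :: m a) (x := y a) (by simp [h]) ih]
    simp [pairs]

end Pairs

/-! ### Counting matrices and transfer of eigenvalues -/

/-- The matrix whose entry `(i, j)` is the number of occurrences of `i` in `f j`. -/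
def countMatrix (S : Type*) [NatCast S] {A B : Type*} [DecidableEq B] (f : A → List B) :
    Matrix B A S :=
  Matrix.of fun i j => ((f j).count i : S)

theorem countMatrix_flatMap (S : Type*) [CommRing S] {A B C : Type*} [Fintype B] [DecidableEq B]
    [DecidableEq C] (f : A → List B) (g : B → List C) :
    countMatrix S (fun a => (f a).flatMap g) = countMatrix S g * countMatrix S f := by
  ext i j
  simp only [countMatrix, Matrix.of_apply, Matrix.mul_apply]
  induction f j with
  | nil => simp
  | cons b u ih =>
    simp only [List.flatMap_cons, List.count_append, Nat.cast_add, ih, List.count_cons]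
    simp [mul_add, Finset.sum_add_distrib, add_comm]

theorem countMatrix_append (S : Type*) [CommRing S] {A B : Type*} [DecidableEq B]
    (f g : A → List B) :
    countMatrix S (fun a => f a ++ g a) = countMatrix S f + countMatrix S g := by
  ext i j
  simp [countMatrix]

theorem countMatrix_congr_perm (S : Type*) [CommRing S] {A B : Type*} [DecidableEq B]
    {f g : A → List B} (h : ∀ a, (f a).Perm (g a)) : countMatrix S f = countMatrix S g := by
  ext i j
  simp [countMatrix, (h j).count_eq i]

/-- `μ` is an eigenvalue of the complex matrix `M`. -/
def HasEig {A : Type*} [Fintype A] (M : Matrix A A ℂ) (μ : ℂ) : Prop :=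
  ∃ v : A → ℂ, v ≠ 0 ∧ M.mulVec v = μ • v

theorem isEigenvalue_iff_hasEig {A : Type*} [Fintype A] [DecidableEq A] (M : Matrix A A ℤ) (μ : ℂ) :
    IsEigenvalue M μ ↔ HasEig (M.map (Int.cast : ℤ → ℂ)) μ := by
  unfold IsEigenvalue HasEig
  constructor
  · intro h
    obtain ⟨v, hv⟩ := h.exists_hasEigenvector
    exact ⟨v, hv.2, by simpa using hv.apply_eq_smul⟩
  · rintro ⟨v, hv, h⟩
    exact Module.End.hasEigenvalue_of_hasEigenvector
      (x := v) ⟨Module.End.mem_eigenspace_iff.2 (by simpa using h), hv⟩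

theorem hasEig_iff_det {A : Type*} [Fintype A] [DecidableEq A] (M : Matrix A A ℂ) (μ : ℂ) :
    HasEig M μ ↔ (M - μ • 1).det = 0 := by
  rw [← Matrix.exists_mulVec_eq_zero_iff]
  simp [HasEig, Matrix.sub_mulVec, Matrix.smul_mulVec, sub_eq_zero]

theorem hasEig_iff_left {A : Type*} [Fintype A] (M : Matrix A A ℂ) (μ : ℂ) :
    HasEig M μ ↔ ∃ v : A → ℂ, v ≠ 0 ∧ Matrix.vecMul v M = μ • v := by
  classical
  rw [hasEig_iff_det, ← Matrix.exists_vecMul_eq_zero_iff]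
  simp [Matrix.vecMul_sub, Matrix.vecMul_smul, sub_eq_zero]

theorem hasEig_sq_iff {A : Type*} [Fintype A] [DecidableEq A] (M : Matrix A A ℂ) (ν : ℂ) :
    HasEig (M ^ 2) (ν ^ 2) ↔ HasEig M ν ∨ HasEig M (-ν) := by
  simp only [hasEig_iff_det]
  have : M ^ 2 - ν ^ 2 • (1 : Matrix A A ℂ) = (M - (-ν) • 1) * (M - ν • 1) := by
    rw [neg_smul, sub_neg_eq_add, ← ((Commute.one_right M).smul_right ν).sq_sub_sq, smul_pow,
      one_pow]
  rw [this, Matrix.det_mul, mul_eq_zero, or_comm]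

theorem HasEig.of_intertwine {A B : Type*} [Fintype A] [Fintype B] {M : Matrix A A ℂ}
    {N : Matrix B B ℂ} {X : Matrix B A ℂ} (h : X * M = N * X) {μ : ℂ} {v : A → ℂ}
    (hv : M.mulVec v = μ • v) (hX : X.mulVec v ≠ 0) : HasEig N μ :=
  ⟨X.mulVec v, hX, by
    rw [Matrix.mulVec_mulVec, ← h, ← Matrix.mulVec_mulVec, hv, Matrix.mulVec_smul]⟩

/-- If `M = E X` and `X M = N X`, then nonzero eigenvalues of `M` are eigenvalues of `N`. -/
theorem HasEig.of_factor {A B : Type*} [Fintype A] [Fintype B] {M : Matrix A A ℂ}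
    {N : Matrix B B ℂ} {X : Matrix B A ℂ} {E : Matrix A B ℂ} (hE : M = E * X)
    (h : X * M = N * X) {μ : ℂ} (hμ : μ ≠ 0) (hM : HasEig M μ) : HasEig N μ := by
  obtain ⟨v, hv0, hv⟩ := hM
  refine HasEig.of_intertwine h hv fun h0 => hv0 ?_
  have : μ • v = 0 := by rw [← hv, hE, ← Matrix.mulVec_mulVec, h0, Matrix.mulVec_zero]
  exact (smul_eq_zero.1 this).resolve_left hμ

theorem hasEig_mul_comm {A B : Type*} [Fintype A] [Fintype B] (X : Matrix A B ℂ)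
    (Y : Matrix B A ℂ) {μ : ℂ} (hμ : μ ≠ 0) : HasEig (X * Y) μ ↔ HasEig (Y * X) μ :=
  ⟨HasEig.of_factor rfl (by rw [Matrix.mul_assoc]) hμ,
    HasEig.of_factor rfl (by rw [Matrix.mul_assoc]) hμ⟩

/-- If `N = K F + T` with `T` idempotent and `F N = M F`, then the eigenvalues of `N` other than
`0` and `1` are eigenvalues of `M`. -/
theorem HasEig.of_quotient {A B : Type*} [Fintype A] [Fintype B] {M : Matrix A A ℂ}
    {N T : Matrix B B ℂ} {F : Matrix A B ℂ} {K : Matrix B A ℂ} (hN : N = K * F + T)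
    (hT : T * T = T) (h : F * N = M * F) {μ : ℂ} (h0 : μ ≠ 0) (h1 : μ ≠ 1) (hM : HasEig N μ) :
    HasEig M μ := by
  obtain ⟨v, hv0, hv⟩ := hM
  refine HasEig.of_intertwine h hv fun hF => hv0 ?_
  have hTv : T.mulVec v = μ • v := by
    rw [← hv, hN, Matrix.add_mulVec, ← Matrix.mulVec_mulVec, hF, Matrix.mulVec_zero, zero_add]
  have h2 : T.mulVec (T.mulVec v) = T.mulVec v := by rw [Matrix.mulVec_mulVec, hT]
  rw [hTv, Matrix.mulVec_smul, hTv] at h2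
  have h3 : (μ * (μ - 1)) • v = 0 := by
    rw [mul_smul, sub_smul, one_smul, smul_sub, h2, sub_self]
  exact (smul_eq_zero.1 h3).resolve_left (mul_ne_zero h0 (sub_ne_zero.2 h1))

/-- If `Y N = M Y` and `M³ - M²` factors through `Y`, then the eigenvalues of `M` other than
`0` and `1` are eigenvalues of `N`. -/
theorem HasEig.of_cube_sub_sq {A B : Type*} [Fintype A] [DecidableEq A] [Fintype B]
    {M : Matrix A A ℂ} {N : Matrix B B ℂ} {Y : Matrix A B ℂ} {G : Matrix B A ℂ}
    (h : Y * N = M * Y) (hG : M * M * M - M * M = Y * G) {μ : ℂ} (h0 : μ ≠ 0) (h1 : μ ≠ 1)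
    (hM : HasEig M μ) : HasEig N μ := by
  rw [hasEig_iff_left] at hM ⊢
  obtain ⟨φ, hφ0, hφ⟩ := hM
  refine ⟨Matrix.vecMul φ Y, fun hY => hφ0 ?_, ?_⟩
  · have h2 : Matrix.vecMul φ (M * M * M - M * M) = (μ * μ * (μ - 1)) • φ := by
      rw [Matrix.vecMul_sub]
      simp only [← Matrix.vecMul_vecMul, hφ, Matrix.smul_vecMul, smul_smul, ← sub_smul]
      congr 1
      ring
    rw [hG, ← Matrix.vecMul_vecMul, hY, Matrix.zero_vecMul] at h2
    exact (smul_eq_zero.1 h2.symm).resolve_left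
      (mul_ne_zero (mul_ne_zero h0 h0) (sub_ne_zero.2 h1))
  · rw [Matrix.vecMul_vecMul, h, ← Matrix.vecMul_vecMul, hφ, Matrix.smul_vecMul]

/-! ### Return words and the derived substitution -/

/-- A map `ρ` on letters acting on a factorial language `L`, with idempotent last-letter and
first-letter maps `f` and `g`, and a word `r l` of `L` occurring in all images, such that `ρ r`
ends with `r` and `ρ l` begins with `l`. -/
structure IsSetup {A : Type*} (ρ : A → List A) (L : Set (List A)) (r l : A) (f g : A → A) :
    Prop where
  head (b : A) : (ρ b).head? = some (g b)
  last (b : A) : (ρ b).getLast? = some (f b)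
  head_idem (b : A) : g (g b) = g b
  last_idem (b : A) : f (f b) = f b
  last_r : f r = r
  head_l : g l = l
  factor {u v : List A} : v ∈ L → u <:+: v → u ∈ L
  image {u : List A} : u ∈ L → u.flatMap ρ ∈ L
  letter (b : A) : [b] ∈ L
  cut_mem : [r, l] ∈ L
  cut (b : A) : [r, l] <:+: ρ b

/-- `w` is a return word to the position in the middle of `r l`. -/
structure IsReturn {A : Type*} [DecidableEq A] (L : Set (List A)) (r l : A) (w : List A) :
    Prop where
  head : w.head? = some l
  last : w.getLast? = some r
  chain : w.IsChain fun x y => noCut r l x y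
  mem : r :: (w ++ [l]) ∈ L

/-- The type of return words. -/
abbrev ReturnWord {A : Type*} [DecidableEq A] (L : Set (List A)) (r l : A) : Type _ :=
  {w : List A // IsReturn L r l w}

section Language

variable {A : Type*} {ρ : A → List A} {L : Set (List A)} {r l : A} {f g : A → A}

theorem head?_flatMap (hg : ∀ b, (ρ b).head? = some (g b)) {u : List A} {a : A}
    (h : u.head? = some a) : (u.flatMap ρ).head? = some (g a) := by
  obtain ⟨z, rfl⟩ := List.head?_eq_some_iff.1 h
  rw [List.flatMap_cons, List.head?_append, hg a]
  rfl

theorem getLast?_flatMap (hf : ∀ b, (ρ b).getLast? = some (f b)) {u : List A} {a : A}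
    (h : u.getLast? = some a) : (u.flatMap ρ).getLast? = some (f a) := by
  obtain ⟨z, rfl⟩ := List.getLast?_eq_some_iff.1 h
  rw [List.flatMap_append, List.getLast?_append]
  simp [hf a]

theorem IsSetup.image_infix (hS : IsSetup ρ L r l f g) {w : List A} (h : r :: (w ++ [l]) ∈ L) :
    r :: (w.flatMap ρ ++ [l]) ∈ L := by
  refine hS.factor (hS.image h) ?_
  have h1 := hS.last r
  have h2 := hS.head l
  rw [hS.last_r] at h1
  rw [hS.head_l] at h2
  obtain ⟨x, hx⟩ := List.getLast?_eq_some_iff.1 h1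
  obtain ⟨y, hy⟩ := List.head?_eq_some_iff.1 h2
  exact ⟨x, y, by simp [hx, hy]⟩

end Language

section Setup

variable {A : Type*} [DecidableEq A] {ρ : A → List A} {L : Set (List A)} {r l : A} {f g : A → A}

theorem IsReturn.ne_nil {w : List A} (h : IsReturn L r l w) : w ≠ [] := by
  rintro rfl
  simpa using h.head

theorem IsSetup.isReturn_of_mem_pieces (hS : IsSetup ρ L r l f g) {u w : List A}
    (hl : u.head? = some l) (hr : u.getLast? = some r) (hm : r :: (u ++ [l]) ∈ L)
    (hw : w ∈ pieces r l u) : IsReturn L r l w := by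
  obtain ⟨s, t, hst⟩ := List.append_of_mem hw
  have hu : u = s.flatten ++ (w ++ t.flatten) := by
    rw [← flatten_pieces (r := r) (l := l) u, hst]
    simp
  have hwn := ne_nil_of_mem_pieces hw
  have h1 : w.head? = some l ∧ ∃ s', r :: s.flatten = s' ++ [r] := by
    rcases eq_or_ne s [] with rfl | hs
    · rw [hu] at hl
      simp only [List.flatten_nil, List.nil_append, List.head?_append] at hl
      rw [List.head?_eq_some_head hwn] at hl ⊢
      exact ⟨by simpa using hl, [], rfl⟩
    · obtain ⟨-, -, h3, h4⟩ := pieces_split hst hs (by simp)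
      rw [List.flatten_cons, List.head?_append] at h4
      rw [List.head?_eq_some_head hwn] at h4 ⊢
      obtain ⟨z, hz⟩ := List.getLast?_eq_some_iff.1 h3
      exact ⟨by simpa using h4, r :: z, by simp [hz]⟩
  have h2 : w.getLast? = some r ∧ ∃ t', t.flatten ++ [l] = l :: t' := by
    rcases eq_or_ne t [] with rfl | ht
    · rw [hu] at hr
      simp only [List.flatten_nil, List.append_nil, List.getLast?_append] at hr
      rw [List.getLast?_eq_getLast_of_ne_nil hwn] at hr ⊢
      exact ⟨by simpa using hr, [], rfl⟩
    · have hst' : pieces r l u = (s ++ [w]) ++ t := by simp [hst]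
      obtain ⟨-, -, h3, h4⟩ := pieces_split hst' (by simp) ht
      rw [List.flatten_append, List.getLast?_append] at h3
      simp only [List.flatten_cons, List.flatten_nil, List.append_nil] at h3
      rw [List.getLast?_eq_getLast_of_ne_nil hwn] at h3 ⊢
      obtain ⟨z, hz⟩ := List.head?_eq_some_iff.1 h4
      exact ⟨by simpa using h3, z ++ [l], by simp [hz]⟩
  obtain ⟨hwl, s', hs'⟩ := h1
  obtain ⟨hwr, t', ht'⟩ := h2
  refine ⟨hwl, hwr, isChain_of_mem_pieces hw, hS.factor hm ⟨s', t', ?_⟩⟩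
  calc s' ++ r :: (w ++ [l]) ++ t' = (s' ++ [r]) ++ w ++ (l :: t') := by simp
    _ = (r :: s.flatten) ++ w ++ (t.flatten ++ [l]) := by rw [hs', ht']
    _ = r :: (u ++ [l]) := by rw [hu]; simp

/-- A word between two occurrences of the cutting position is a product of return words. -/
theorem IsSetup.exists_returnWords (hS : IsSetup ρ L r l f g) {u : List A}
    (hl : u.head? = some l) (hr : u.getLast? = some r) (hm : r :: (u ++ [l]) ∈ L) :
    ∃ t : List (ReturnWord L r l), t.map Subtype.val = pieces r l u := by
  have := fun w (hw : w ∈ pieces r l u) => hS.isReturn_of_mem_pieces hl hr hm hw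
  lift pieces r l u to List (ReturnWord L r l) using this with t ht
  exact ⟨t, rfl⟩

/-- The substitution `τ` induced by `ρ` on the return words exists. -/
theorem IsSetup.exists_derived (hS : IsSetup ρ L r l f g) :
    ∃ τ : ReturnWord L r l → List (ReturnWord L r l),
      ∀ w, (τ w).map Subtype.val = pieces r l (w.1.flatMap ρ) := by
  have : ∀ w : ReturnWord L r l, ∃ t : List (ReturnWord L r l),
      t.map Subtype.val = pieces r l (w.1.flatMap ρ) := fun w =>
    hS.exists_returnWords (by rw [head?_flatMap hS.head w.2.head, hS.head_l])
      (by rw [getLast?_flatMap hS.last w.2.last, hS.last_r]) (hS.image_infix w.2.mem)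
  choose τ hτ using this
  exact ⟨τ, hτ⟩

/-- The pieces of the images of return words, up to the common first piece. -/
theorem IsSetup.pieces_image (hS : IsSetup ρ L r l f g) {x y : A → List A}
    {m : A → List (List A)} (h : ∀ a, pieces r l (ρ a) = x a :: (m a ++ [y a]))
    (w : ReturnWord L r l) :
    pieces r l (w.1.flatMap ρ) ++ [x l] = x l ::
      (pairs w.1 l).flatMap fun p => m p.1 ++ pieces r l (y p.1 ++ x p.2) := by
  have h1 := pieces_flatMap_append h w.1 l
  have h2 : w.1.headD l = l := by
    obtain ⟨z, hz⟩ := List.head?_eq_some_iff.1 w.2.head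
    simp [hz]
  have h3 : (x l).head? = some l := by
    have h4 := hS.head l
    rw [← flatten_pieces (r := r) (l := l) (ρ l), h l, hS.head_l, List.flatten_cons,
      List.head?_append] at h4
    have hx : x l ≠ [] := ne_nil_of_mem_pieces (r := r) (l := l) (u := ρ l) (by simp [h])
    rw [List.head?_eq_some_head hx] at h4 ⊢
    simpa using h4
  rw [pieces_append (by rw [getLast?_flatMap hS.last w.2.last, hS.last_r]) h3, h2] at h1
  rw [← h1, pieces_of_mem_pieces (r := r) (l := l) (u := ρ l) (w := x l) (by simp [h])]

theorem flatMap_val {τ : ReturnWord L r l → List (ReturnWord L r l)}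
    (hτ : ∀ w, (τ w).map Subtype.val = pieces r l (w.1.flatMap ρ))
    (w : ReturnWord L r l) : (τ w).flatMap Subtype.val = w.1.flatMap ρ := by
  rw [List.flatMap_def, hτ, flatten_pieces]

/-! ### Comparison of the eigenvalues of `ρ` and `τ` -/

section Eigenvalues

variable [Fintype A] [Fintype (ReturnWord L r l)]
  {τ : ReturnWord L r l → List (ReturnWord L r l)}

theorem IsSetup.hasEig_of_derived (hS : IsSetup ρ L r l f g)
    (hτ : ∀ w, (τ w).map Subtype.val = pieces r l (w.1.flatMap ρ)) {μ : ℂ} (h0 : μ ≠ 0)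
    (h1 : μ ≠ 1) (h : HasEig (countMatrix ℂ τ) μ) : HasEig (countMatrix ℂ ρ) μ := by
  choose x m y hxy using fun a => exists_pieces_eq (hS.cut a)
  let p : ReturnWord L r l → List (A × A) := fun w => pairs w.1 l
  let q : A × A → List (A × A) := fun z => pairs (ρ z.1) (g z.2)
  let ε : A × A → List (List A) := fun z => m z.1 ++ pieces r l (y z.1 ++ x z.2)
  have hpq : ∀ w, (τ w).flatMap p = (p w).flatMap q := by
    intro w
    have e1 := pairs_flatMap hS.head w.1 l
    have e2 := pairs_flatten (l := l) ((τ w).map Subtype.val) (by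
      intro v hv
      obtain ⟨v, -, rfl⟩ := List.mem_map.1 hv
      exact v.2.head)
    rw [← List.flatMap_def, flatMap_val hτ, List.flatMap_map] at e2
    rw [hS.head_l] at e1
    exact e2.symm.trans e1
  have hE : countMatrix ℂ τ =
      (countMatrix ℂ ε).submatrix Subtype.val id * countMatrix ℂ p := by
    have e1 : countMatrix ℂ ε * countMatrix ℂ p =
        countMatrix ℂ (fun w : ReturnWord L r l => pieces r l (w.1.flatMap ρ)) := by
      rw [← countMatrix_flatMap]
      refine countMatrix_congr_perm ℂ fun w => ?_
      -- Moving the common first piece `x l` from the front to the end makes the pieces a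
      -- concatenation over pairs; counts do not see this rotation.
      have e2 := hS.pieces_image hxy w
      have e3 : (x l :: pieces r l (w.1.flatMap ρ)).Perm (x l :: (p w).flatMap ε) := by
        rw [← e2]
        exact (List.perm_append_singleton _ _).symm
      exact e3.cons_inv.symm
    ext i j
    change _ = (countMatrix ℂ ε * countMatrix ℂ p) i.1 j
    rw [e1]
    simp only [countMatrix, Matrix.of_apply, ← hτ]
    congr 1
    induction τ j with
    | nil => rfl
    | cons v t ih => simp [List.count_cons, ih, Subtype.ext_iff]
  have hQ : HasEig (countMatrix ℂ q) μ := by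
    refine HasEig.of_factor hE ?_ h0 h
    rw [← countMatrix_flatMap, ← countMatrix_flatMap]
    exact congrArg _ (funext hpq)
  let F : A × A → List A := fun z => [z.1]
  let T : A × A → List (A × A) := fun z => [(f z.1, g z.2)]
  -- Only the last pair of `q (a, c)` depends on `c`.
  have hK : ∃ K : A → List (A × A), ∀ z, q z = K z.1 ++ T z := by
    have : ∀ a, ∃ k, ∀ c, pairs (ρ a) c = k ++ [(f a, c)] := by
      intro a
      obtain ⟨z, hz⟩ := List.getLast?_eq_some_iff.1 (hS.last a)
      exact ⟨pairs z (f a), fun c => by rw [hz, pairs_append]; rfl⟩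
    choose K hK using this
    exact ⟨K, fun z => hK _ _⟩
  obtain ⟨K, hK⟩ := hK
  refine HasEig.of_quotient (F := countMatrix ℂ F) (K := countMatrix ℂ K)
    (T := countMatrix ℂ T) ?_ ?_ ?_ h0 h1 hQ
  · rw [← countMatrix_flatMap, ← countMatrix_append]
    exact congrArg _ (funext fun z => by simp [hK, F])
  · rw [← countMatrix_flatMap]
    exact congrArg _ (funext fun z => by simp [T, hS.head_idem, hS.last_idem])
  · rw [← countMatrix_flatMap, ← countMatrix_flatMap]
    refine congrArg _ (funext fun z => ?_)
    have : ∀ u : List (A × A), u.flatMap F = u.map Prod.fst := fun u => by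
      induction u with
      | nil => rfl
      | cons a u ih => simp [F, ih]
    rw [this, map_fst_pairs]
    simp [F]

theorem IsSetup.hasEig_derived (hS : IsSetup ρ L r l f g)
    (hτ : ∀ w, (τ w).map Subtype.val = pieces r l (w.1.flatMap ρ)) {μ : ℂ} (h0 : μ ≠ 0)
    (h1 : μ ≠ 1) (h : HasEig (countMatrix ℂ ρ) μ) : HasEig (countMatrix ℂ τ) μ := by
  have hsplit : ∀ a, ∃ p q, ρ a = p ++ q ∧ p.getLast? = some r ∧ q.head? = some l := by
    intro a
    obtain ⟨X, Y, hXY⟩ := hS.cut a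
    exact ⟨X ++ [r], l :: Y, by simp [← hXY], by simp, by simp⟩
  choose p q hpq hp hq using hsplit
  -- Split `ρ a` and `ρ b` at a cut: what lies between the two cuts is a product of return words,
  -- and the two outer ends depend only on `a` and `b`.
  have key : ∀ (a b : A) (z : List A), (a :: (z ++ [b])) ∈ L →
      ∃ G : List (ReturnWord L r l), ((a :: (z ++ [b])).flatMap ρ).Perm
        ((p a ++ q b) ++ G.flatMap Subtype.val) := by
    intro a b z hz
    have e : (a :: (z ++ [b])).flatMap ρ = p a ++ (q a ++ z.flatMap ρ ++ p b) ++ q b := by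
      simp [hpq]
    obtain ⟨p', hp'⟩ := List.getLast?_eq_some_iff.1 (hp a)
    obtain ⟨q', hq'⟩ := List.head?_eq_some_iff.1 (hq b)
    obtain ⟨G, hG⟩ := hS.exists_returnWords (u := q a ++ z.flatMap ρ ++ p b)
      (by rw [List.append_assoc, List.head?_append, hq]; rfl)
      (by rw [List.getLast?_append, hp]; rfl)
      (hS.factor (hS.image hz) ⟨p', q', by rw [e, hp', hq']; simp⟩)
    refine ⟨G, ?_⟩
    rw [List.flatMap_def (l := G), hG, flatten_pieces, e]
    generalize q a ++ z.flatMap ρ ++ p b = v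
    rw [List.append_assoc, List.append_assoc]
    exact List.Perm.append_left _ List.perm_append_comm
  have hends : ∀ b, ∃ z, ρ b = g b :: (z ++ [f b]) := by
    intro b
    obtain ⟨X, Y, hXY⟩ := hS.cut b
    have e1 := hS.head b
    have e2 := hS.last b
    obtain ⟨z, hz⟩ := List.head?_eq_some_iff.1 e1
    rcases List.eq_nil_or_concat z with rfl | ⟨z', c, rfl⟩
    · have := congrArg List.length (hXY.trans hz)
      simp at this
      omega
    · rw [hz, List.concat_eq_append, ← List.cons_append, List.getLast?_concat] at e2
      exact ⟨z', by rw [hz, ← Option.some_injective _ e2, List.concat_eq_append]⟩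
  -- By idempotence `ρ²(b)` has the same end letters as `ρ(b)`, so the outer ends given by `key` for
  -- `ρ²(b)` and `ρ³(b)` coincide and cancel in the difference.
  have hends2 : ∀ b, ∃ z, (ρ b).flatMap ρ = g b :: (z ++ [f b]) := by
    intro b
    obtain ⟨z, hz⟩ := hends b
    obtain ⟨z1, hz1⟩ := hends (g b)
    obtain ⟨z2, hz2⟩ := hends (f b)
    refine ⟨z1 ++ [f (g b)] ++ z.flatMap ρ ++ g (f b) :: z2, ?_⟩
    rw [hz]
    simp [hz1, hz2, hS.head_idem, hS.last_idem]
  have hL1 : ∀ b, ρ b ∈ L := fun b => by simpa using hS.image (hS.letter b)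
  have hG1 : ∀ b, ∃ G : List (ReturnWord L r l), ((ρ b).flatMap ρ).Perm
      ((p (g b) ++ q (f b)) ++ G.flatMap Subtype.val) := by
    intro b
    obtain ⟨z, hz⟩ := hends b
    have := key (g b) (f b) z (hz ▸ hL1 b)
    rwa [← hz] at this
  have hG2 : ∀ b, ∃ G : List (ReturnWord L r l), (((ρ b).flatMap ρ).flatMap ρ).Perm
      ((p (g b) ++ q (f b)) ++ G.flatMap Subtype.val) := by
    intro b
    obtain ⟨z, hz⟩ := hends2 b
    have := key (g b) (f b) z (hz ▸ hS.image (hL1 b))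
    rwa [← hz] at this
  choose G1 hG1 using hG1
  choose G2 hG2 using hG2
  refine HasEig.of_cube_sub_sq (Y := countMatrix ℂ (Subtype.val : ReturnWord L r l → List A))
    (G := countMatrix ℂ G2 - countMatrix ℂ G1) ?_ ?_ h0 h1 h
  · rw [← countMatrix_flatMap, ← countMatrix_flatMap]
    exact congrArg _ (funext fun w => flatMap_val hτ w)
  · have e1 : countMatrix ℂ ρ * countMatrix ℂ ρ = countMatrix ℂ fun b => (ρ b).flatMap ρ :=
      (countMatrix_flatMap ℂ ρ ρ).symm
    rw [Matrix.mul_assoc, e1, ← countMatrix_flatMap, countMatrix_congr_perm ℂ hG1,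
      countMatrix_congr_perm ℂ hG2, countMatrix_append ℂ (fun b => p (g b) ++ q (f b)),
      countMatrix_append ℂ (fun b => p (g b) ++ q (f b)), countMatrix_flatMap,
      countMatrix_flatMap, Matrix.mul_sub]
    abel

end Eigenvalues

end Setup

/-! ### Endomorphisms of the free monoid as maps on letters -/

section LetterImage

variable {A : Type*}

theorem toList_apply_ofList (σ : Monoid.End (FreeMonoid A)) (u : List A) :
    FreeMonoid.toList (σ (FreeMonoid.ofList u)) = u.flatMap (letterImage σ) := by
  induction u with
  | nil => simp
  | cons a u ih =>
    rw [FreeMonoid.ofList_cons, map_mul, FreeMonoid.toList_mul, ih]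
    rfl

theorem letterImage_mul (σ τ : Monoid.End (FreeMonoid A)) (b : A) :
    letterImage (σ * τ) b = (letterImage τ b).flatMap (letterImage σ) :=
  toList_apply_ofList σ (letterImage τ b)

theorem letterImage_one (b : A) : letterImage (1 : Monoid.End (FreeMonoid A)) b = [b] := rfl

theorem flatMap_letterImage_one (u : List A) :
    u.flatMap (letterImage (1 : Monoid.End (FreeMonoid A))) = u := by
  induction u with
  | nil => rfl
  | cons a u ih => rw [List.flatMap_cons, ih]; rfl

theorem flatMap_letterImage_mul (σ τ : Monoid.End (FreeMonoid A)) (u : List A) :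
    u.flatMap (letterImage (σ * τ)) = (u.flatMap (letterImage τ)).flatMap (letterImage σ) := by
  rw [List.flatMap_assoc]
  exact congrArg (List.flatMap · u) (funext fun b => letterImage_mul σ τ b)

theorem incidenceMatrix_eq_countMatrix [DecidableEq A] (σ : Monoid.End (FreeMonoid A)) :
    incidenceMatrix σ = countMatrix ℤ (letterImage σ) := rfl

theorem map_incidenceMatrix [DecidableEq A] (σ : Monoid.End (FreeMonoid A)) :
    (incidenceMatrix σ).map (Int.cast : ℤ → ℂ) = countMatrix ℂ (letterImage σ) := by
  ext i j
  simp [incidenceMatrix, countMatrix]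

theorem incidenceMatrix_mul [Fintype A] [DecidableEq A] (σ τ : Monoid.End (FreeMonoid A)) :
    incidenceMatrix (σ * τ) = incidenceMatrix σ * incidenceMatrix τ := by
  simp only [incidenceMatrix_eq_countMatrix, ← countMatrix_flatMap]
  exact congrArg _ (funext fun b => letterImage_mul σ τ b)

theorem incidenceMatrix_pow [Fintype A] [DecidableEq A] (σ : Monoid.End (FreeMonoid A)) (n : ℕ) :
    incidenceMatrix (σ ^ n) = incidenceMatrix σ ^ n := by
  induction n with
  | zero =>
    ext i j
    simp [incidenceMatrix, letterImage_one, Matrix.one_apply, List.count_cons, eq_comm (a := i)]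
  | succ n ih => rw [pow_succ, pow_succ, incidenceMatrix_mul, ih]

theorem infix_flatMap_of_mem {B : Type*} (f : A → List B) {a : A} {u : List A} (h : a ∈ u) :
    f a <:+: u.flatMap f := by
  obtain ⟨s, t, rfl⟩ := List.append_of_mem h
  exact ⟨s.flatMap f, t.flatMap f, by simp⟩

theorem infix_flatMap {B : Type*} (f : A → List B) {u v : List A} (h : u <:+: v) :
    u.flatMap f <:+: v.flatMap f := by
  obtain ⟨s, t, rfl⟩ := h
  exact ⟨s.flatMap f, t.flatMap f, by simp⟩

end LetterImage

/-! ### The tower substitution -/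

theorem exists_nonempty_parts {R : Type*} {n : ℕ} (hn : 0 < n) {t : List R} (h : n ≤ t.length) :
    ∃ p : Fin n → List R, (∀ j, p j ≠ []) ∧ (List.ofFn p).flatten = t := by
  induction n, hn using Nat.le_induction generalizing t with
  | base => exact ⟨fun _ => t, fun _ => by rintro rfl; simp at h, by simp⟩
  | succ n hn ih =>
    obtain ⟨a, t', rfl⟩ := List.exists_cons_of_length_pos (l := t) (by omega)
    obtain ⟨p, hp, hpt⟩ := ih (t := t') (by simpa using h)
    refine ⟨Fin.cons [a] p, fun j => ?_, by
      rw [List.ofFn_succ, List.flatten_cons]; simp only [Fin.cons_zero, Fin.cons_succ, hpt]; rfl⟩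
    cases j using Fin.cases <;> simp [hp]

section Tower

variable {R B : Type*} {len : R → ℕ} (e : (Σ w : R, Fin (len w)) ≃ B)

/-- The word `(w, 0) (w, 1) ⋯` of letters of the tower over `w`. -/
def towerWord (w : R) : List B := List.ofFn fun j => e ⟨w, j⟩

/-- The substitution on the tower, mapping the letter `(w, j)` to the tower words of the image
under `τ` of the `j`-th part of `τ w`. -/
def towerSubst (τ : R → List R) (parts : (w : R) → Fin (len w) → List R) :
    Monoid.End (FreeMonoid B) :=
  FreeMonoid.lift fun b => FreeMonoid.ofList
    (((parts (e.symm b).1 (e.symm b).2).flatMap τ).flatMap (towerWord e))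

variable {e} {τ : R → List R} {parts : (w : R) → Fin (len w) → List R}

theorem letterImage_towerSubst (b : B) : letterImage (towerSubst e τ parts) b =
    ((parts (e.symm b).1 (e.symm b).2).flatMap τ).flatMap (towerWord e) := by
  exact congrArg FreeMonoid.toList (FreeMonoid.lift_eval_of _ b)

theorem towerWord_flatMap_parts (hp : ∀ w, (List.ofFn (parts w)).flatten = τ w) (w : R) :
    ((towerWord e w).flatMap fun b => parts (e.symm b).1 (e.symm b).2) = τ w := by
  rw [← hp w, towerWord, List.flatMap_def, List.map_ofFn]
  congr 2
  funext j
  simp only [Function.comp_apply]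
  rw [e.symm_apply_apply]

theorem towerWord_flatMap (hp : ∀ w, (List.ofFn (parts w)).flatten = τ w) (w : R) :
    (towerWord e w).flatMap (letterImage (towerSubst e τ parts)) =
      ((τ w).flatMap τ).flatMap (towerWord e) := by
  rw [← towerWord_flatMap_parts (e := e) hp w, List.flatMap_assoc, List.flatMap_assoc]
  exact congrArg (List.flatMap · (towerWord e w)) (funext fun b => by
    rw [letterImage_towerSubst, List.flatMap_assoc])

theorem towerWord_ne_nil (hl : ∀ w, 0 < len w) (w : R) : towerWord e w ≠ [] := by
  have := hl w
  intro h
  have := congrArg List.length h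
  simp [towerWord] at this
  omega

theorem mem_towerWord (b : B) : b ∈ towerWord e (e.symm b).1 := by
  rw [towerWord, List.mem_ofFn]
  exact ⟨(e.symm b).2, by simp⟩

theorem head?_flatMap_of_const {X Y : Type*} {F : X → List Y} {y : Y}
    (h : ∀ x, (F x).head? = some y) {u : List X} (hu : u ≠ []) :
    (u.flatMap F).head? = some y := by
  obtain ⟨x, t, rfl⟩ := List.exists_cons_of_ne_nil hu
  rw [List.flatMap_cons, List.head?_append, h]
  rfl

theorem getLast?_flatMap_of_const {X Y : Type*} {F : X → List Y} {y : Y}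
    (h : ∀ x, (F x).getLast? = some y) {u : List X} (hu : u ≠ []) :
    (u.flatMap F).getLast? = some y := by
  obtain ⟨t, x, rfl⟩ := List.eq_nil_or_concat u |>.resolve_left hu
  rw [List.concat_eq_append, List.flatMap_append, List.getLast?_append]
  simp [h]

theorem isProper_towerSubst (hl : ∀ w, 0 < len w) (hp : ∀ w j, parts w j ≠ []) {w₁ w₂ : R}
    (h1 : ∀ w, (τ w).head? = some w₁) (h2 : ∀ w, (τ w).getLast? = some w₂) :
    IsProper (towerSubst e τ parts) := by
  constructor
  · refine ⟨(towerWord e w₁).head (towerWord_ne_nil hl w₁), fun b => ?_⟩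
    rw [letterImage_towerSubst]
    obtain ⟨z, hz⟩ :=
      List.head?_eq_some_iff.1 (head?_flatMap_of_const h1 (hp (e.symm b).1 (e.symm b).2))
    rw [hz, List.flatMap_cons, List.head?_append, List.head?_eq_some_head (towerWord_ne_nil hl w₁)]
    rfl
  · refine ⟨(towerWord e w₂).getLast (towerWord_ne_nil hl w₂), fun b => ?_⟩
    rw [letterImage_towerSubst]
    obtain ⟨z, hz⟩ :=
      List.getLast?_eq_some_iff.1 (getLast?_flatMap_of_const h2 (hp (e.symm b).1 (e.symm b).2))
    rw [hz, List.flatMap_append, List.getLast?_append]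
    simp [List.getLast?_eq_getLast_of_ne_nil (towerWord_ne_nil hl w₂)]

/-- A part is nonempty and a single application of `τ` already produces every return word. This is
the use of the extra `τ` in `towerSubst`. -/
theorem towerWord_infix (hp : ∀ w j, parts w j ≠ []) (hτ : ∀ w v, v ∈ τ w) (w : R) (b : B) :
    towerWord e w <:+: letterImage (towerSubst e τ parts) b := by
  rw [letterImage_towerSubst]
  refine infix_flatMap_of_mem _ ?_
  obtain ⟨x, t, hx⟩ := List.exists_cons_of_ne_nil (hp (e.symm b).1 (e.symm b).2)
  simp [hx, hτ]

theorem mem_letterImage_towerSubst (hp : ∀ w j, parts w j ≠ []) (hτ : ∀ w v, v ∈ τ w) (a b : B) :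
    a ∈ letterImage (towerSubst e τ parts) b :=
  (towerWord_infix hp hτ (e.symm a).1 b).subset (mem_towerWord a)

theorem isPrimitive_towerSubst [Fintype B] [DecidableEq B] (hp : ∀ w j, parts w j ≠ [])
    (hτ : ∀ w v, v ∈ τ w) : IsPrimitive (towerSubst e τ parts) := by
  refine ⟨fun i j => by simp [incidenceMatrix], 1, one_pos, fun i j => ?_⟩
  simpa [incidenceMatrix, List.count_pos_iff] using mem_letterImage_towerSubst hp hτ i j

theorem length_flatMap_le {X Y : Type*} {F : X → List Y} {c : ℕ} (h : ∀ x, c ≤ (F x).length)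
    (u : List X) : c * u.length ≤ (u.flatMap F).length := by
  induction u with
  | nil => simp
  | cons x u ih =>
    have := h x
    simp only [List.flatMap_cons, List.length_append, List.length_cons]
    nlinarith

theorem length_flatMap_le' {X Y : Type*} {F : X → List Y} {c : ℕ} {u : List X}
    (h : ∀ x ∈ u, (F x).length ≤ c) : (u.flatMap F).length ≤ c * u.length := by
  induction u with
  | nil => simp
  | cons x u ih =>
    have h1 := h x (by simp)
    have h2 := ih fun y hy => h y (by simp [hy])
    simp only [List.flatMap_cons, List.length_append, List.length_cons]
    nlinarith

theorem isSubstitution_of_isLeftProper {σ : Monoid.End (FreeMonoid B)} (h : IsLeftProper σ)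
    (h2 : ∀ b, 2 ≤ (letterImage σ b).length) : IsSubstitution σ := by
  obtain ⟨a, ha⟩ := h
  refine ⟨⟨a, ha a⟩, fun b => ?_⟩
  have : ∀ n, n ≤ (letterImage (σ ^ n) b).length := by
    intro n
    suffices 2 ^ n ≤ (letterImage (σ ^ n) b).length from Nat.lt_two_pow_self.le.trans this
    induction n with
    | zero => simp [letterImage_one]
    | succ n ih =>
      rw [pow_succ', pow_succ' σ, letterImage_mul]
      exact (Nat.mul_le_mul_left 2 ih).trans (length_flatMap_le h2 _)
  exact Filter.tendsto_atTop_mono this Filter.tendsto_id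

theorem two_le_length_towerSubst (hl : ∀ w, 0 < len w) (hp : ∀ w j, parts w j ≠ [])
    (h2 : ∀ w, 2 ≤ (τ w).length) (b : B) :
    2 ≤ (letterImage (towerSubst e τ parts) b).length := by
  rw [letterImage_towerSubst]
  have e1 := length_flatMap_le (F := towerWord e) (c := 1) (fun w => by
    rw [towerWord, List.length_ofFn]; exact hl w)
    ((parts (e.symm b).1 (e.symm b).2).flatMap τ)
  have e2 := length_flatMap_le h2 (parts (e.symm b).1 (e.symm b).2)
  have e3 := List.length_pos_iff.2 (hp (e.symm b).1 (e.symm b).2)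
  omega

/-- Taking parts and then towers over `τ` gives the tower substitution; composing in the other
order, the parts of the tower over `v` recombine to `τ v`, which gives `τ²`. -/
theorem hasEig_towerSubst [Fintype R] [DecidableEq R] [Fintype B] [DecidableEq B]
    (hp : ∀ w, (List.ofFn (parts w)).flatten = τ w) {μ : ℂ} (hμ : μ ≠ 0) :
    HasEig (countMatrix ℂ (letterImage (towerSubst e τ parts))) μ ↔
      HasEig (countMatrix ℂ τ ^ 2) μ := by
  have h1 : countMatrix ℂ (letterImage (towerSubst e τ parts)) =
      countMatrix ℂ (fun w => (τ w).flatMap (towerWord e)) *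
        countMatrix ℂ fun b => parts (e.symm b).1 (e.symm b).2 := by
    rw [← countMatrix_flatMap]
    refine congrArg _ (funext fun b => ?_)
    rw [letterImage_towerSubst, List.flatMap_assoc]
  have h2 : countMatrix ℂ τ ^ 2 = (countMatrix ℂ fun b => parts (e.symm b).1 (e.symm b).2) *
      countMatrix ℂ (fun w => (τ w).flatMap (towerWord e)) := by
    rw [pow_two, ← countMatrix_flatMap, ← countMatrix_flatMap]
    refine congrArg _ (funext fun w => ?_)
    rw [List.flatMap_assoc]
    exact congrArg (List.flatMap · (τ w)) (funext fun v => (towerWord_flatMap_parts hp v).symm)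
  rw [h1, h2, hasEig_mul_comm _ _ hμ]

end Tower

/-! ### Conjugacies induced by letter-to-letter maps -/

section Conjugacy

variable {A B : Type*}

theorem language_of_infix {σ : Monoid.End (FreeMonoid A)} {u v : List A} (hv : v ∈ language σ)
    (h : u <:+: v) : u ∈ language σ := by
  obtain ⟨n, b, hb⟩ := hv
  exact ⟨n, b, h.trans hb⟩

theorem length_factor (x : ℤ → A) (i : ℤ) (n : ℕ) : (factor x i n).length = n := by
  simp [factor]

theorem map_factor (π : B → A) (x : ℤ → B) (i : ℤ) (n : ℕ) :
    (factor x i n).map π = factor (π ∘ x) i n := by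
  simp [factor, List.map_ofFn, Function.comp_def]

theorem factor_add (x : ℤ → A) (i : ℤ) (m n : ℕ) :
    factor x i (m + n) = factor x i m ++ factor x (i + m) n := by
  simp [factor, List.ofFn_add, add_assoc]

theorem factor_infix (x : ℤ → A) (i : ℤ) (a n b : ℕ) :
    factor x (i + a) n <:+: factor x i (a + n + b) := by
  rw [factor_add, factor_add]
  exact ⟨_, _, rfl⟩

theorem factor_succ_succ (x : ℤ → A) (N : ℕ) :
    factor x (-(N + 1 : ℕ)) (2 * (N + 1) + 1) =
      factor x (-(N + 1 : ℕ)) 1 ++ (factor x (-N) (2 * N + 1) ++ factor x (N + 1) 1) := by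
  have e1 : 2 * (N + 1) + 1 = 1 + ((2 * N + 1) + 1) := by ring
  rw [e1, factor_add, factor_add]
  congr 3 <;> push_cast <;> ring_nf

/-- A letter-to-letter map which maps the language of `ξ` onto that of `σ` and which is injective
on `Ω_ξ` induces a conjugacy. -/
theorem conjugate_of_letterMap [TopologicalSpace A] [DiscreteTopology A] [TopologicalSpace B]
    [DiscreteTopology B] [Finite B] {σ : Monoid.End (FreeMonoid A)} {ξ : Monoid.End (FreeMonoid B)}
    (π : B → A) (h1 : ∀ u ∈ language ξ, u.map π ∈ language σ)
    (h2 : ∀ u ∈ language σ, ∃ v ∈ language ξ, v.map π = u)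
    (hinj : ∀ x ∈ (omega ξ).carrier, ∀ y ∈ (omega ξ).carrier, π ∘ x = π ∘ y → x = y) :
    Conjugate (omega σ) (omega ξ) := by
  have hmem : ∀ x ∈ (omega ξ).carrier, π ∘ x ∈ (omega σ).carrier := by
    intro x hx i n
    rw [← map_factor]
    exact h1 _ (hx i n)
  let F : (omega ξ).carrier → (omega σ).carrier := fun x => ⟨π ∘ x.1, hmem x.1 x.2⟩
  have hFc : Continuous F := by
    refine Continuous.subtype_mk (continuous_pi fun i => ?_) _
    exact continuous_of_discreteTopology.comp ((continuous_apply i).comp continuous_subtype_val)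
  have hFi : Function.Injective F := fun x y hxy =>
    Subtype.ext (hinj x.1 x.2 y.1 y.2 (congrArg Subtype.val hxy))
  have hFs : Function.Surjective F := by
    intro y
    -- Surjectivity by compactness: these nested nonempty closed sets lift longer and longer central
    -- windows of `y`, and a common point is a preimage.
    let t : ℕ → Set (ℤ → B) := fun N =>
      {x | factor (π ∘ x) (-N) (2 * N + 1) = factor y.1 (-N) (2 * N + 1) ∧
        factor x (-N) (2 * N + 1) ∈ language ξ}
    have hstep : ∀ N, t (N + 1) ⊆ t N := by
      rintro N x ⟨hx1, hx2⟩
      rw [factor_succ_succ, factor_succ_succ] at hx1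
      rw [factor_succ_succ] at hx2
      have e1 := (List.append_inj hx1 (by simp [length_factor])).2
      exact ⟨(List.append_inj e1 (by simp [length_factor])).1,
        language_of_infix hx2 ⟨_, _, by rw [List.append_assoc]⟩⟩
    have hne : ∀ N, (t N).Nonempty := by
      intro N
      obtain ⟨v, hv, hvy⟩ := h2 _ (y.2 (-N) (2 * N + 1))
      have hlen : v.length = 2 * N + 1 := by
        rw [← List.length_map (as := v) π, hvy, length_factor]
      let x : ℤ → B := fun i => v.getD (i + N).toNat (v.head (by rintro rfl; simp at hlen))
      have hx : factor x (-N) (2 * N + 1) = v := by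
        refine List.ext_getElem (by rw [length_factor, hlen]) fun k h1 h2 => ?_
        simp only [factor, x, List.getElem_ofFn]
        rw [show (-(N : ℤ) + (k : ℤ) + N).toNat = k by omega, List.getD_eq_getElem _ _ h2]
      refine ⟨x, ?_, ?_⟩
      · rw [← map_factor, hx, hvy]
      · rw [hx]
        exact hv
    have hcl : ∀ N, IsClosed (t N) := by
      intro N
      have : t N = (fun x : ℤ → B => fun k : Fin (2 * N + 1) => x (-N + (k : ℤ))) ⁻¹'
          {v | (List.ofFn v).map π = factor y.1 (-N) (2 * N + 1) ∧ List.ofFn v ∈ language ξ} := by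
        ext x
        simp only [t, ← map_factor]
        rfl
      rw [this]
      exact (isClosed_discrete _).preimage (by fun_prop)
    obtain ⟨x, hx⟩ := IsCompact.nonempty_iInter_of_sequence_nonempty_isCompact_isClosed t hstep
      hne (hcl 0).isCompact hcl
    have hx' := Set.mem_iInter.1 hx
    have hxm : x ∈ (omega ξ).carrier := by
      intro i n
      let N := i.natAbs + n
      obtain ⟨a, ha⟩ : ∃ a : ℕ, i = -N + a := ⟨(i + N).toNat, by omega⟩
      obtain ⟨b, hb⟩ : ∃ b : ℕ, 2 * N + 1 = a + n + b := ⟨2 * N + 1 - (a + n), by omega⟩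
      refine language_of_infix (hx' N).2 ?_
      rw [hb, ha]
      exact factor_infix _ _ _ _ _
    refine ⟨⟨x, hxm⟩, Subtype.ext (funext fun i => ?_)⟩
    have e1 := (hx' i.natAbs).1
    have e2 := congrArg (fun u => u[(i + i.natAbs).toNat]?) e1
    have e3 : (i + i.natAbs).toNat < 2 * i.natAbs + 1 := by omega
    have e4 : -(i.natAbs : ℤ) + ((i + i.natAbs).toNat : ℤ) = i := by omega
    rw [List.getElem?_eq_getElem (by rwa [length_factor]),
      List.getElem?_eq_getElem (by rwa [length_factor])] at e2
    simp only [factor, List.getElem_ofFn, e4] at e2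
    exact Option.some_injective _ e2
  let E : (omega ξ).carrier ≃ (omega σ).carrier := Equiv.ofBijective F ⟨hFi, hFs⟩
  have : CompactSpace (omega ξ).carrier :=
    isCompact_iff_compactSpace.1 (omega ξ).isClosed.isCompact
  have hE : Continuous E := hFc
  refine ⟨hE.homeoOfEquivCompactToT2.symm, fun z => ?_⟩
  obtain ⟨x, rfl⟩ := hE.homeoOfEquivCompactToT2.surjective z
  rw [Homeomorph.symm_apply_apply]
  apply hE.homeoOfEquivCompactToT2.injective
  rw [Homeomorph.apply_symm_apply]
  rfl

end Conjugacy

/-! ### Injectivity of the projection of towers -/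

section TowerCoding

variable {A R B : Type*} {word : R → List A} (e : (Σ w : R, Fin (word w).length) ≃ B)

/-- The base `w` of the letter `(w, j)` of the tower. -/
def towerBase (b : B) : R := (e.symm b).1

/-- The height `j` of the letter `(w, j)` of the tower. -/
def towerIndex (b : B) : ℕ := (e.symm b).2

/-- The letter of `A` below the letter `(w, j)` of the tower. -/
def towerLetter (b : B) : A := (word (e.symm b).1).get (e.symm b).2

/-- The possible transitions between successive letters of the tower. -/
def TowerAdj (r l : A) (b c : B) : Prop :=
  (towerIndex e b + 1 = (word (towerBase e b)).length ∧ towerIndex e c = 0 ∧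
      towerLetter e b = r ∧ towerLetter e c = l) ∨
    (towerBase e c = towerBase e b ∧ towerIndex e c = towerIndex e b + 1 ∧
      ¬ (towerLetter e b = r ∧ towerLetter e c = l))

variable {e}

theorem towerIndex_lt (b : B) : towerIndex e b < (word (towerBase e b)).length := (e.symm b).2.2

theorem towerBase_apply (w : R) (j : Fin (word w).length) : towerBase e (e ⟨w, j⟩) = w := by
  rw [towerBase, e.symm_apply_apply]

theorem towerIndex_apply (w : R) (j : Fin (word w).length) : towerIndex e (e ⟨w, j⟩) = j := by
  rw [towerIndex, e.symm_apply_apply]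

theorem towerLetter_apply (w : R) (j : Fin (word w).length) :
    towerLetter e (e ⟨w, j⟩) = (word w)[j] := by
  rw [towerLetter, e.symm_apply_apply]
  rfl

theorem map_towerLetter (w : R) : (towerWord e w).map (towerLetter e) = word w := by
  rw [towerWord, List.map_ofFn]
  refine List.ext_getElem (by simp) fun i h1 h2 => ?_
  rw [List.getElem_ofFn, Function.comp_apply, towerLetter_apply]
  rfl

theorem map_flatMap_towerWord (u : List R) :
    (u.flatMap (towerWord e)).map (towerLetter e) = u.flatMap word := by
  rw [List.map_flatMap]
  exact congrArg (List.flatMap · u) (funext map_towerLetter)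

theorem towerAdj_of_word [DecidableEq A] {r l : A} (h0 : ∀ w, word w ≠ [])
    (hl : ∀ w, (word w).head? = some l) (hr : ∀ w, (word w).getLast? = some r)
    (hc : ∀ w, (word w).IsChain fun x y => noCut r l x y) (u : List R) :
    (u.flatMap (towerWord e)).IsChain (TowerAdj e r l) := by
  have hpos : ∀ w, 0 < (word w).length := fun w => List.length_pos_iff.2 (h0 w)
  rw [List.flatMap_def, List.isChain_flatten]
  · constructor
    · intro v hv
      obtain ⟨w, -, rfl⟩ := List.mem_map.1 hv
      rw [towerWord, List.isChain_ofFn]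
      intro i hi
      refine Or.inr ⟨by simp only [towerBase_apply], by simp only [towerIndex_apply], ?_⟩
      have := noCut_eq_true.1 ((List.isChain_iff_getElem.1 (hc w)) i hi)
      rwa [towerLetter_apply, towerLetter_apply]
    · rw [List.isChain_map]
      refine List.isChain_iff_getElem.2 fun i hi => ?_
      generalize u[i] = w
      generalize u[i + 1] = v
      have hw := hpos w
      have hv := hpos v
      intro x hx y hy
      have ex : x = e ⟨w, ⟨(word w).length - 1, by omega⟩⟩ := by
        rw [towerWord, List.getLast?_eq_getElem?] at hx
        rw [List.getElem?_eq_getElem (by simp; omega), Option.mem_some_iff, List.getElem_ofFn] at hx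
        rw [← hx]
        simp
      have ey : y = e ⟨v, ⟨0, hv⟩⟩ := by
        rw [towerWord, List.head?_eq_getElem?] at hy
        rw [List.getElem?_eq_getElem (by simp; omega), Option.mem_some_iff, List.getElem_ofFn] at hy
        rw [← hy]
      subst ex ey
      have e1 := hl v
      have e2 := hr w
      rw [List.head?_eq_getElem?, List.getElem?_eq_getElem hv] at e1
      rw [List.getLast?_eq_getElem?, List.getElem?_eq_getElem (by omega)] at e2
      refine Or.inl ⟨?_, ?_, ?_, ?_⟩
      · rw [towerIndex_apply, towerBase_apply, Nat.sub_add_cancel hw]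
      · rw [towerIndex_apply]
      · rw [towerLetter_apply]
        exact Option.some_injective _ e2
      · rw [towerLetter_apply]
        exact Option.some_injective _ e1
  · intro h
    obtain ⟨w, -, hw⟩ := List.mem_map.1 h
    exact towerWord_ne_nil hpos w hw

theorem TowerAdj.injective {r l : A} (hword : Function.Injective word) {x y : ℤ → B}
    (hx : ∀ i, TowerAdj e r l (x i) (x (i + 1))) (hy : ∀ i, TowerAdj e r l (y i) (y (i + 1)))
    (hxy : towerLetter e ∘ x = towerLetter e ∘ y) : x = y := by
  have hlet : ∀ i, towerLetter e (x i) = towerLetter e (y i) := fun i => congrFun hxy i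
  -- Index `0` occurs exactly after a cut `r l`, which is visible in the common projection; higher
  -- indices count the distance to it.
  have hidx : ∀ (k : ℕ) (i : ℤ), towerIndex e (x i) = k → towerIndex e (y i) = k := by
    intro k
    induction k with
    | zero =>
      intro i hi
      have h1 := hx (i - 1)
      have h2 := hy (i - 1)
      rw [sub_add_cancel] at h1 h2
      rcases h1 with h1 | h1
      · rcases h2 with h2 | h2
        · exact h2.2.1
        · exact absurd ⟨hlet _ ▸ h1.2.2.1, hlet _ ▸ h1.2.2.2⟩ h2.2.2
      · omega
    | succ k ih =>
      intro i hi
      have h1 := hx (i - 1)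
      have h2 := hy (i - 1)
      rw [sub_add_cancel] at h1 h2
      rcases h1 with h1 | h1
      · omega
      · rcases h2 with h2 | h2
        · refine absurd ⟨?_, ?_⟩ h1.2.2
          · rw [hlet]; exact h2.2.2.1
          · rw [hlet]; exact h2.2.2.2
        · rw [h2.2.1, ih (i - 1) (by omega)]
  have hrun : ∀ {z : ℤ → B}, (∀ i, TowerAdj e r l (z i) (z (i + 1))) → ∀ (i : ℤ) (d : ℕ),
      towerIndex e (z i) + d < (word (towerBase e (z i))).length →
        towerBase e (z (i + d)) = towerBase e (z i) ∧
          towerIndex e (z (i + d)) = towerIndex e (z i) + d := by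
    intro z hz i d
    induction d with
    | zero => simp
    | succ d ih =>
      intro hd
      obtain ⟨e1, e2⟩ := ih (by omega)
      have h1 := hz (i + d)
      rw [show i + ((d + 1 : ℕ) : ℤ) = i + d + 1 by push_cast; ring]
      rcases h1 with h1 | h1
      · rw [e1] at h1
        omega
      · exact ⟨h1.1.trans e1, by omega⟩
  have hend : ∀ {z : ℤ → B}, (∀ i, TowerAdj e r l (z i) (z (i + 1))) → ∀ (i : ℤ),
      towerIndex e (z i) = 0 → towerIndex e (z (i + (word (towerBase e (z i))).length)) = 0 := by
    intro z hz i hi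
    have h3 := towerIndex_lt (e := e) (z i)
    obtain ⟨n, hn⟩ : ∃ n, (word (towerBase e (z i))).length = n + 1 :=
      ⟨(word (towerBase e (z i))).length - 1, by omega⟩
    obtain ⟨e1, e2⟩ := hrun hz i n (by omega)
    rw [hn, show i + ((n + 1 : ℕ) : ℤ) = i + n + 1 by push_cast; ring]
    rcases hz (i + n) with h1 | h1
    · exact h1.2.1
    · have h4 := towerIndex_lt (e := e) (z (i + n + 1))
      rw [h1.1, e1] at h4
      omega
  have hletter : ∀ {z : ℤ → B} (i : ℤ), (word (towerBase e (z i)))[towerIndex e (z i)]? =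
      some (towerLetter e (z i)) := fun {z} i => by
    rw [List.getElem?_eq_getElem (towerIndex_lt (e := e) (z i))]
    rfl
  have hidx' : ∀ i, towerIndex e (x i) = towerIndex e (y i) := fun i => (hidx _ i rfl).symm
  -- Both towers starting at `i` end at the next index `0`, so they have equal length, and their
  -- words are read off the common projection.
  have hzero : ∀ i, towerIndex e (x i) = 0 → towerBase e (x i) = towerBase e (y i) := by
    intro i hi
    have hi' := hidx 0 i hi
    have hlen : (word (towerBase e (x i))).length = (word (towerBase e (y i))).length := by
      have p1 := towerIndex_lt (e := e) (x i)
      have p2 := towerIndex_lt (e := e) (y i)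
      rcases lt_trichotomy (word (towerBase e (x i))).length (word (towerBase e (y i))).length
        with h | h | h
      · have h1 := hend hx i hi
        have h2 := (hrun hy i _ (by rw [hi']; simpa using h)).2
        rw [hidx'] at h1
        omega
      · exact h
      · have h1 := hend hy i hi'
        have h2 := (hrun hx i _ (by rw [hi]; simpa using h)).2
        rw [← hidx'] at h1
        omega
    refine hword (List.ext_getElem hlen fun j h1 h2 => ?_)
    obtain ⟨a1, a2⟩ := hrun hx i j (by omega)
    obtain ⟨b1, b2⟩ := hrun hy i j (by omega)
    have c1 := hletter (z := x) (i + j)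
    have c2 := hletter (z := y) (i + j)
    rw [a1, a2, hi, zero_add] at c1
    rw [b1, b2, hi', zero_add] at c2
    rw [← hlet, ← c1] at c2
    rw [List.getElem?_eq_getElem h1, List.getElem?_eq_getElem h2] at c2
    exact (Option.some_injective _ c2).symm
  have hown : ∀ (k : ℕ) (i : ℤ), towerIndex e (x i) = k →
      towerBase e (x i) = towerBase e (y i) := by
    intro k
    induction k with
    | zero => exact hzero
    | succ k ih =>
      intro i hi
      have h1 := hx (i - 1)
      have h2 := hy (i - 1)
      have hi' := hidx' i
      rw [sub_add_cancel] at h1 h2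
      rcases h1 with h1 | h1
      · omega
      · rcases h2 with h2 | h2
        · omega
        · rw [h1.1, h2.1, ih (i - 1) (by omega)]
  funext i
  apply e.symm.injective
  have h1 : (e.symm (x i)).1 = (e.symm (y i)).1 := hown _ i rfl
  have h2 : (e.symm (x i)).2.1 = (e.symm (y i)).2.1 := hidx' i
  generalize e.symm (x i) = p at h1 h2
  generalize e.symm (y i) = q at h1 h2
  obtain ⟨p1, p2⟩ := p
  obtain ⟨q1, q2⟩ := q
  obtain rfl : p1 = q1 := h1
  exact congrArg _ (Fin.ext h2)

end TowerCoding

/-! ### Powers of a primitive substitution -/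

section Substitution

variable {A : Type*} {σ : Monoid.End (FreeMonoid A)}

theorem IsSubstitution.letterImage_ne_nil (h : IsSubstitution σ) (b : A) :
    letterImage σ b ≠ [] := by
  intro hb
  obtain ⟨n, hn⟩ := ((h.2 b).eventually_ge_atTop 1).exists_forall_of_atTop
  have := hn (n + 1) (by omega)
  rw [pow_succ, letterImage_mul, hb] at this
  simp at this

theorem head?_letterImage_pow {g : A → A} (hg : ∀ b, (letterImage σ b).head? = some (g b)) (n : ℕ)
    (b : A) : (letterImage (σ ^ n) b).head? = some (g^[n] b) := by
  induction n with
  | zero => rfl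
  | succ n ih => rw [pow_succ', letterImage_mul, head?_flatMap hg ih, Function.iterate_succ_apply']

theorem getLast?_letterImage_pow {f : A → A} (hf : ∀ b, (letterImage σ b).getLast? = some (f b))
    (n : ℕ) (b : A) : (letterImage (σ ^ n) b).getLast? = some (f^[n] b) := by
  induction n with
  | zero => rfl
  | succ n ih =>
    rw [pow_succ', letterImage_mul, getLast?_flatMap hf ih, Function.iterate_succ_apply']

theorem letterImage_mem_language (n : ℕ) (b : A) : letterImage (σ ^ n) b ∈ language σ :=
  ⟨n, b, List.infix_rfl⟩

theorem flatMap_mem_language {u : List A} (hu : u ∈ language σ) (n : ℕ) :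
    u.flatMap (letterImage (σ ^ n)) ∈ language σ := by
  obtain ⟨m, b, hb⟩ := hu
  refine ⟨n + m, b, ?_⟩
  rw [pow_add, letterImage_mul]
  exact infix_flatMap _ hb

theorem IsPrimitive.eventually_infix [Fintype A] [DecidableEq A] (hp : IsPrimitive σ)
    (h0 : ∀ b, letterImage σ b ≠ []) {u : List A} (hu : u ∈ language σ) :
    ∀ᶠ n in Filter.atTop, ∀ b, u <:+: letterImage (σ ^ n) b := by
  obtain ⟨m, a, ha⟩ := hu
  obtain ⟨k, -, hk⟩ := hp.exists_pos_pow
  have hmem : ∀ a b, a ∈ letterImage (σ ^ k) b := by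
    intro a b
    have := hk a b
    rw [← incidenceMatrix_pow] at this
    simpa [incidenceMatrix, List.count_pos_iff] using this
  have hne : ∀ n b, letterImage (σ ^ n) b ≠ [] := by
    intro n b
    have h1 : (letterImage (σ ^ n) b).head? =
        some ((fun b => (letterImage σ b).head (h0 b))^[n] b) :=
      head?_letterImage_pow (fun b => List.head?_eq_some_head (h0 b)) n b
    intro h2
    simp [h2] at h1
  filter_upwards [Filter.eventually_ge_atTop (m + k)] with n hn b
  obtain ⟨j, rfl⟩ := Nat.exists_eq_add_of_le hn
  obtain ⟨c, t, hc⟩ := List.exists_cons_of_ne_nil (hne j b)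
  rw [pow_add, pow_add, letterImage_mul, hc, flatMap_letterImage_mul]
  refine ha.trans (infix_flatMap_of_mem _ ?_)
  simp [hmem]

/-- A factor longer than two maximal blocks cannot avoid containing a whole block. -/
theorem exists_block_infix {B : Type*} {F : A → List B} {C : ℕ} (hC : ∀ a, (F a).length ≤ C)
    {u : List B} (hu : 2 * C < u.length) (v : List A) (h : u <:+: v.flatMap F) :
    ∃ a, F a <:+: u := by
  induction v with
  | nil =>
    have : u.length ≤ 0 := h.length_le
    omega
  | cons a v ih =>
    obtain ⟨X, Y, hXY⟩ := h
    rw [List.flatMap_cons, List.append_assoc] at hXY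
    have ha := hC a
    rcases List.append_eq_append_iff.1 hXY with ⟨w, hw1, hw2⟩ | ⟨w, hw1, hw2⟩
    · rcases List.append_eq_append_iff.1 hw2 with ⟨z, hz1, hz2⟩ | ⟨z, hz1, hz2⟩
      · have := congrArg List.length hw1
        rw [hz1] at this
        simp at this
        omega
      · have l1 := congrArg List.length hw1
        have l2 := congrArg List.length hz1
        simp only [List.length_append] at l1 l2
        cases v with
        | nil =>
          have := congrArg List.length hz2
          simp at this
          omega
        | cons b v =>
          rw [List.flatMap_cons] at hz2
          have hb := hC b
          rcases List.append_eq_append_iff.1 hz2 with ⟨y, hy1, -⟩ | ⟨y, hy1, -⟩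
          · refine ⟨b, w, y, ?_⟩
            rw [hz1, hy1, List.append_assoc]
          · have l3 := congrArg List.length hy1
            simp only [List.length_append] at l3
            omega
    · exact ih ⟨w, Y, by rw [List.append_assoc]; exact hw2.symm⟩

/-- For some `n` every block `σⁿ(a)` contains `r l`. A return word longer than two such blocks would
contain a whole one, hence an interior cut. -/
theorem finite_setOf_isReturn [Fintype A] [DecidableEq A] (hp : IsPrimitive σ)
    (h0 : ∀ b, letterImage σ b ≠ []) {r l : A} (hrl : [r, l] ∈ language σ) :
    {w | IsReturn (language σ) r l w}.Finite := by
  obtain ⟨n, hn⟩ := (hp.eventually_infix h0 hrl).exists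
  obtain ⟨C, hC⟩ : ∃ C, ∀ a, (letterImage (σ ^ n) a).length ≤ C :=
    ⟨Finset.univ.sup fun a => (letterImage (σ ^ n) a).length,
      fun a => Finset.le_sup (f := fun a => (letterImage (σ ^ n) a).length) (Finset.mem_univ a)⟩
  refine (List.finite_length_le A (2 * C)).subset fun w hw => ?_
  by_contra hlen
  have hw' : w ∈ language σ := language_of_infix hw.mem ⟨[r], [l], by simp⟩
  obtain ⟨m, hm, hmn⟩ := ((hp.eventually_infix h0 hw').and (Filter.eventually_ge_atTop n)).exists
  obtain ⟨j, rfl⟩ := Nat.exists_eq_add_of_le hmn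
  have h1 := hm r
  rw [pow_add, letterImage_mul] at h1
  obtain ⟨a, ha⟩ := exists_block_infix hC (by simpa using hlen) _ h1
  have h2 := hw.chain.infix ((hn a).trans ha)
  simp [noCut] at h2

theorem exists_iterate_stable {X : Type*} [Finite X] (h : X → X) :
    ∃ p, 0 < p ∧ ∀ j, h^[p * (j + 1)] = h^[p] := by
  obtain ⟨a, b, hab, heq⟩ := Finite.exists_ne_map_eq_of_infinite fun n : ℕ => h^[n]
  wlog hlt : a < b generalizing a b
  · exact this b a hab.symm heq.symm (by omega)
  -- The iterates are periodic from `a` on with period `d + 1`; a multiple of the period that is at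
  -- least `a` serves as `p`.
  obtain ⟨d, rfl⟩ := Nat.exists_eq_add_of_lt hlt
  have h1 : ∀ c j, h^[a + c + (d + 1) * j] = h^[a + c] := by
    intro c j
    induction j with
    | zero => rfl
    | succ j ih =>
      have e1 : a + c + (d + 1) * (j + 1) = (c + (d + 1) * j) + (a + d + 1) := by ring
      have e2 : (c + (d + 1) * j) + a = a + c + (d + 1) * j := by ring
      rw [e1, Function.iterate_add, ← heq, ← Function.iterate_add, e2, ih]
  refine ⟨(d + 1) * (a + 1), by positivity, fun j => ?_⟩
  have h2 := h1 (d * a + d + 1) ((a + 1) * j)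
  have e1 : a + (d * a + d + 1) = (d + 1) * (a + 1) := by ring
  have e2 : (d + 1) * (a + 1) + (d + 1) * ((a + 1) * j) = (d + 1) * (a + 1) * (j + 1) := by ring
  rwa [e1, e2] at h2

/-- A power of a primitive substitution acts on its language as in `IsSetup`, and the images of
letters are as long, and contain as many words, as desired. -/
theorem exists_setup [Fintype A] [DecidableEq A] (hsub : IsSubstitution σ) (hp : IsPrimitive σ) :
    ∃ (k : ℕ) (r l : A) (f g : A → A), 0 < k ∧
      IsSetup (letterImage (σ ^ k)) (language σ) r l f g ∧
      {w | IsReturn (language σ) r l w}.Finite ∧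
      (∀ w, IsReturn (language σ) r l w → ∀ b, r :: (w ++ [l]) <:+: letterImage (σ ^ k) b) ∧
      ∃ C, 0 < C ∧ (∀ w, IsReturn (language σ) r l w → w.length ≤ C) ∧
        ∀ b, C ≤ (letterImage (σ ^ k) b).length := by
  have h0 := hsub.letterImage_ne_nil
  choose g hg using fun b => (⟨_, List.head?_eq_some_head (h0 b)⟩ :
    ∃ c, (letterImage σ b).head? = some c)
  choose f hf using fun b => (⟨_, List.getLast?_eq_getLast_of_ne_nil (h0 b)⟩ :
    ∃ c, (letterImage σ b).getLast? = some c)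
  obtain ⟨p, hp0, hpf⟩ := exists_iterate_stable f
  obtain ⟨q, hq0, hqg⟩ := exists_iterate_stable g
  -- The end-letter maps do not depend on `j`, so `r` and `l` can be fixed first and the power
  -- enlarged afterwards.
  have hF : ∀ j, f^[p * q * (j + 1)] = f^[p] := by
    intro j
    rw [show p * q * (j + 1) = p * ((q * (j + 1) - 1) + 1) by
      rw [Nat.sub_add_cancel (Nat.mul_pos hq0 j.succ_pos), mul_assoc]]
    exact hpf _
  have hG : ∀ j, g^[p * q * (j + 1)] = g^[q] := by
    intro j
    rw [mul_comm p q, show q * p * (j + 1) = q * ((p * (j + 1) - 1) + 1) by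
      rw [Nat.sub_add_cancel (Nat.mul_pos hp0 j.succ_pos), mul_assoc]]
    exact hqg _
  have hFF : ∀ b, f^[p] (f^[p] b) = f^[p] b := fun b => by
    rw [← Function.iterate_add_apply, ← two_mul, mul_comm]
    exact congrFun (hpf 1) b
  have hGG : ∀ b, g^[q] (g^[q] b) = g^[q] b := fun b => by
    rw [← Function.iterate_add_apply, ← two_mul, mul_comm]
    exact congrFun (hqg 1) b
  have hlast : ∀ j b, (letterImage (σ ^ (p * q * (j + 1))) b).getLast? = some (f^[p] b) :=
    fun j b => by rw [getLast?_letterImage_pow hf, hF]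
  have hhead : ∀ j b, (letterImage (σ ^ (p * q * (j + 1))) b).head? = some (g^[q] b) :=
    fun j b => by rw [head?_letterImage_pow hg, hG]
  obtain ⟨x, y, hxy⟩ : ∃ x y, [x, y] ∈ language σ := by
    obtain ⟨a, -⟩ := hsub.1
    obtain ⟨n, hn⟩ := ((hsub.2 a).eventually_ge_atTop 2).exists
    have hm := letterImage_mem_language (σ := σ) n a
    rcases h : letterImage (σ ^ n) a with _ | ⟨x, _ | ⟨y, t⟩⟩
    · simp [h] at hn
    · simp [h] at hn
    · exact ⟨x, y, language_of_infix hm ⟨[], t, by simp [h]⟩⟩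
  have hrl : [f^[p] x, g^[q] y] ∈ language σ := by
    refine language_of_infix (flatMap_mem_language hxy (p * q * (0 + 1))) ?_
    obtain ⟨u, hu⟩ := List.getLast?_eq_some_iff.1 (hlast 0 x)
    obtain ⟨v, hv⟩ := List.head?_eq_some_iff.1 (hhead 0 y)
    exact ⟨u, v, by simp only [List.flatMap_cons, hu, hv]; simp⟩
  have hfin := finite_setOf_isReturn hp h0 hrl
  obtain ⟨C, hC⟩ : ∃ C, ∀ w, IsReturn (language σ) (f^[p] x) (g^[q] y) w → w.length ≤ C := by
    obtain ⟨C, hC⟩ := (hfin.image List.length).bddAbove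
    exact ⟨C, fun w hw => hC ⟨w, hw, rfl⟩⟩
  have hev1 : ∀ᶠ n in Filter.atTop, ∀ w ∈ {w | IsReturn (language σ) (f^[p] x) (g^[q] y) w},
      ∀ b, f^[p] x :: (w ++ [g^[q] y]) <:+: letterImage (σ ^ n) b :=
    (Filter.eventually_all_finite hfin).2 fun w hw => hp.eventually_infix h0 hw.mem
  have hev2 : ∀ᶠ n in Filter.atTop, ∀ b, C + 1 ≤ (letterImage (σ ^ n) b).length :=
    Filter.eventually_all.2 fun b => (hsub.2 b).eventually_ge_atTop _
  obtain ⟨N, hN⟩ := ((hev1.and hev2).and (hp.eventually_infix h0 hrl)).exists_forall_of_atTop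
  obtain ⟨⟨h1, h2⟩, h3⟩ := hN (p * q * (N + 1)) (by
    have := Nat.le_mul_of_pos_left (N + 1) (Nat.mul_pos hp0 hq0)
    omega)
  exact ⟨p * q * (N + 1), f^[p] x, g^[q] y, f^[p], g^[q], by positivity,
    { head := hhead N
      last := hlast N
      head_idem := hGG
      last_idem := hFF
      last_r := hFF x
      head_l := hGG y
      factor := language_of_infix
      image := fun hu => flatMap_mem_language hu _
      letter := fun b => letterImage_mem_language 0 b
      cut_mem := hrl
      cut := h3 }, hfin, h1, C + 1, by omega, fun w hw => (hC w hw).trans (by omega), h2⟩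

end Substitution

/-! ### Positivity, lengths and properness of `τ` -/

section Derived

variable {A : Type*} [DecidableEq A] {ρ : A → List A} {L : Set (List A)} {r l : A} {f g : A → A}

/-- Cut the prefix of `ρ l` that stops in the middle of an occurrence of `r l`. -/
theorem IsSetup.nonempty_returnWord (hS : IsSetup ρ L r l f g) : Nonempty (ReturnWord L r l) := by
  obtain ⟨X, Y, hXY⟩ := hS.cut l
  have h1 := hS.head l
  have h2 := hS.last r
  rw [hS.last_r] at h2
  obtain ⟨Z, hZ⟩ := List.getLast?_eq_some_iff.1 h2
  rw [hS.head_l, ← hXY] at h1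
  have hm := hS.image hS.cut_mem
  obtain ⟨t, ht⟩ := hS.exists_returnWords (u := X ++ [r]) (by
      cases X with
      | nil => simpa using h1
      | cons a X => simpa using h1) (by simp)
    (hS.factor hm ⟨Z, Y, by simp [hZ, ← hXY]⟩)
  cases t with
  | nil =>
    have := flatten_pieces (r := r) (l := l) (X ++ [r])
    rw [← ht] at this
    simp at this
  | cons w t => exact ⟨w⟩

theorem IsReturn.infix_image {w : List A} (hw : IsReturn L r l w) {u : List A}
    (h : ∀ b, u <:+: ρ b) : u <:+: w.flatMap ρ := by
  obtain ⟨b, t, rfl⟩ := List.exists_cons_of_ne_nil hw.ne_nil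
  exact (h b).trans (infix_flatMap_of_mem ρ (by simp))

variable {τ : ReturnWord L r l → List (ReturnWord L r l)}

theorem mem_derived (hτ : ∀ w, (τ w).map Subtype.val = pieces r l (w.1.flatMap ρ))
    (hfull : ∀ w, IsReturn L r l w → ∀ b, r :: (w ++ [l]) <:+: ρ b) (w v : ReturnWord L r l) :
    v ∈ τ w := by
  have h1 := mem_pieces_of_infix v.2.ne_nil v.2.head v.2.last v.2.chain
    (w.2.infix_image (hfull v.1 v.2))
  rw [← hτ] at h1
  obtain ⟨v', hv', he⟩ := List.mem_map.1 h1
  rwa [← Subtype.ext he]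

theorem two_le_length_derived (hS : IsSetup ρ L r l f g)
    (hτ : ∀ w, (τ w).map Subtype.val = pieces r l (w.1.flatMap ρ)) (w : ReturnWord L r l) :
    2 ≤ (τ w).length := by
  obtain ⟨x, m, y, h⟩ := exists_pieces_eq (w.2.infix_image hS.cut)
  rw [← List.length_map (as := τ w) Subtype.val, hτ, h]
  simp

/-- Compare `C |w| ≤ |ρ(w)| ≤ C |τ w|`. It leaves room for one nonempty part of `τ w` per letter of
`w`. -/
theorem length_le_length_derived (hτ : ∀ w, (τ w).map Subtype.val = pieces r l (w.1.flatMap ρ))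
    {C : ℕ} (hC0 : 0 < C) (hC : ∀ w, IsReturn L r l w → w.length ≤ C)
    (hρ : ∀ b, C ≤ (ρ b).length) (w : ReturnWord L r l) : w.1.length ≤ (τ w).length := by
  have h1 := length_flatMap_le hρ w.1
  have h2 := length_flatMap_le' (F := Subtype.val) (u := τ w) fun v _ => hC v.1 v.2
  rw [flatMap_val hτ] at h2
  exact Nat.le_of_mul_le_mul_left (h1.trans h2) hC0

/-- Every return word begins with `l`, and `ρ l` contains a cut, so the first piece of `ρ(w)` is
that of `ρ l`. -/
theorem exists_head_derived (hS : IsSetup ρ L r l f g)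
    (hτ : ∀ w, (τ w).map Subtype.val = pieces r l (w.1.flatMap ρ)) :
    ∃ w₁, ∀ w, (τ w).head? = some w₁ := by
  choose x m y hxy using fun a => exists_pieces_eq (hS.cut a)
  have h : ∀ w, ((τ w).head?).map Subtype.val = some (x l) := by
    intro w
    have h1 := hS.pieces_image hxy w
    have h2 := two_le_length_derived hS hτ w
    rw [← hτ] at h1
    rcases h : τ w with _ | ⟨v, t⟩
    · simp [h] at h2
    · rw [h, List.map_cons, List.cons_append] at h1
      exact congrArg some (List.cons.inj h1).1
  obtain ⟨w₀⟩ := hS.nonempty_returnWord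
  obtain ⟨w₁, hw₁, he⟩ := Option.map_eq_some_iff.1 (h w₀)
  refine ⟨w₁, fun w => ?_⟩
  obtain ⟨w₂, hw₂, he₂⟩ := Option.map_eq_some_iff.1 (h w)
  rw [hw₂, Subtype.ext (he₂.trans he.symm)]

theorem exists_getLast_derived (hS : IsSetup ρ L r l f g)
    (hτ : ∀ w, (τ w).map Subtype.val = pieces r l (w.1.flatMap ρ)) :
    ∃ w₁, ∀ w, (τ w).getLast? = some w₁ := by
  obtain ⟨x, m, y, hxy⟩ := exists_pieces_eq (hS.cut r)
  have h : ∀ w, ((τ w).getLast?).map Subtype.val = some y := by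
    intro w
    obtain ⟨z, hz⟩ := List.getLast?_eq_some_iff.1 w.2.last
    rw [← List.getLast?_map, hτ, hz, List.flatMap_append, List.flatMap_singleton]
    rcases List.eq_nil_or_concat (pieces r l (z.flatMap ρ)) with h1 | ⟨s, x', h1⟩
    · have h2 := flatten_pieces (r := r) (l := l) (z.flatMap ρ)
      rw [h1] at h2
      rw [← h2, List.flatten_nil, List.nil_append, hxy, ← List.cons_append, List.getLast?_concat]
    · rw [pieces_append_of_eq (by rw [h1, List.concat_eq_append]) hxy, ← List.append_assoc,
        List.getLast?_concat]
  obtain ⟨w₀⟩ := hS.nonempty_returnWord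
  obtain ⟨w₁, hw₁, he⟩ := Option.map_eq_some_iff.1 (h w₀)
  refine ⟨w₁, fun w => ?_⟩
  obtain ⟨w₂, hw₂, he₂⟩ := Option.map_eq_some_iff.1 (h w)
  rw [hw₂, Subtype.ext (he₂.trans he.symm)]

/-- For `μ = ν²`, the condition `μ ≠ 1` excludes both `ν = 1` and `ν = -1`, so the comparison of `ρ`
with `τ` applies to `ν` and to `-ν`. -/
theorem IsSetup.hasEig_sq_iff [Fintype A] [Fintype (ReturnWord L r l)]
    (hS : IsSetup ρ L r l f g) (hτ : ∀ w, (τ w).map Subtype.val = pieces r l (w.1.flatMap ρ))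
    {μ : ℂ} (h0 : μ ≠ 0) (h1 : μ ≠ 1) :
    HasEig (countMatrix ℂ ρ ^ 2) μ ↔ HasEig (countMatrix ℂ τ ^ 2) μ := by
  obtain ⟨ν, rfl⟩ := IsAlgClosed.exists_pow_nat_eq μ two_pos
  have key : ∀ ν : ℂ, ν ≠ 0 → ν ≠ 1 → (HasEig (countMatrix ℂ ρ) ν ↔ HasEig (countMatrix ℂ τ) ν) :=
    fun ν h0 h1 => ⟨hS.hasEig_derived hτ h0 h1, hS.hasEig_of_derived hτ h0 h1⟩
  have hν0 : ν ≠ 0 := by rintro rfl; simp at h0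
  rw [Substitutive.hasEig_sq_iff, Substitutive.hasEig_sq_iff, key ν hν0 (by rintro rfl; simp at h1),
    key (-ν) (neg_ne_zero.2 hν0) fun h => h1 (by rw [← neg_sq, h, one_pow])]

end Derived

/-! ### Conjugacy of `Ω_σ` with the tower subshift -/

section Main

variable {A : Type*} [DecidableEq A] {σ : Monoid.End (FreeMonoid A)} {k : ℕ} {r l : A}
  {f g : A → A} {B : Type*}
  {τ : ReturnWord (language σ) r l → List (ReturnWord (language σ) r l)}
  {e : (Σ w : ReturnWord (language σ) r l, Fin w.1.length) ≃ B}
  {parts : (w : ReturnWord (language σ) r l) → Fin w.1.length →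
    List (ReturnWord (language σ) r l)}

/-- On towers the substitution acts as `τ²`, hence below as `ρ² = σ^(2k)`. -/
theorem flatMap_towerSubst_pow
    (hτ : ∀ w, (τ w).map Subtype.val = pieces r l (w.1.flatMap (letterImage (σ ^ k))))
    (hp : ∀ w, (List.ofFn (parts w)).flatten = τ w) (n : ℕ)
    (u : List (ReturnWord (language σ) r l)) :
    ∃ u' : List (ReturnWord (language σ) r l),
      (u.flatMap (towerWord e)).flatMap (letterImage (towerSubst e τ parts ^ n)) =
        u'.flatMap (towerWord e) ∧
      u'.flatMap Subtype.val =
        (u.flatMap Subtype.val).flatMap (letterImage (σ ^ (k * (2 * n)))) := by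
  have hval : ∀ v : List (ReturnWord (language σ) r l), (v.flatMap τ).flatMap Subtype.val =
      (v.flatMap Subtype.val).flatMap (letterImage (σ ^ k)) := by
    intro v
    rw [List.flatMap_assoc, List.flatMap_assoc]
    exact congrArg (List.flatMap · v) (funext fun w => flatMap_val hτ w)
  induction n with
  | zero => exact ⟨u, flatMap_letterImage_one _, (flatMap_letterImage_one _).symm⟩
  | succ n ih =>
    obtain ⟨u', h1, h2⟩ := ih
    refine ⟨(u'.flatMap τ).flatMap τ, ?_, ?_⟩
    · rw [pow_succ', flatMap_letterImage_mul, h1, List.flatMap_assoc, List.flatMap_assoc,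
        List.flatMap_assoc]
      refine congrArg (List.flatMap · u') (funext fun w => ?_)
      rw [towerWord_flatMap hp, List.flatMap_assoc]
    · rw [hval, hval, h2, ← flatMap_letterImage_mul, ← flatMap_letterImage_mul, ← pow_add,
        ← pow_add]
      congr 3
      ring

theorem conjugate_towerSubst [Fintype A] [TopologicalSpace A] [DiscreteTopology A]
    [TopologicalSpace B] [DiscreteTopology B] [Finite B] (hsub : IsSubstitution σ)
    (hprim : IsPrimitive σ) (hk : 0 < k) (hS : IsSetup (letterImage (σ ^ k)) (language σ) r l f g)
    (hτ : ∀ w, (τ w).map Subtype.val = pieces r l (w.1.flatMap (letterImage (σ ^ k))))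
    (hp : ∀ w, (List.ofFn (parts w)).flatten = τ w) (hp0 : ∀ w j, parts w j ≠ [])
    (hmem : ∀ w v, v ∈ τ w) : Conjugate (omega σ) (omega (towerSubst e τ parts)) := by
  have hcover : ∀ u ∈ language (towerSubst e τ parts),
      ∃ u' : List (ReturnWord (language σ) r l), u <:+: u'.flatMap (towerWord e) ∧
        u'.flatMap Subtype.val ∈ language σ := by
    rintro u ⟨n, b, hb⟩
    obtain ⟨u', h1, h2⟩ := flatMap_towerSubst_pow (e := e) hτ hp n [(e.symm b).1]
    refine ⟨u', ?_, ?_⟩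
    · rw [← h1, List.flatMap_singleton]
      exact hb.trans (infix_flatMap_of_mem _ (mem_towerWord b))
    · rw [h2, List.flatMap_singleton]
      exact flatMap_mem_language (language_of_infix (e.symm b).1.2.mem ⟨[r], [l], by simp⟩) _
  refine conjugate_of_letterMap (towerLetter (word := Subtype.val) e) (fun u hu => ?_)
    (fun u hu => ?_) fun x hx y hy hxy => ?_
  · obtain ⟨u', h1, h2⟩ := hcover u hu
    refine language_of_infix h2 ?_
    rw [← map_flatMap_towerWord (e := e)]
    exact h1.map _
  · obtain ⟨w⟩ := hS.nonempty_returnWord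
    obtain ⟨N, hN⟩ :=
      (hprim.eventually_infix hsub.letterImage_ne_nil hu).exists_forall_of_atTop
    obtain ⟨u', h1, h2⟩ := flatMap_towerSubst_pow (e := e) hτ hp N [w]
    rw [List.flatMap_singleton] at h1 h2
    have h3 : u <:+: u'.flatMap Subtype.val := by
      rw [h2]
      refine w.2.infix_image (hN _ ?_)
      nlinarith
    rw [← map_flatMap_towerWord (e := e), List.infix_map_iff] at h3
    obtain ⟨v, hv, rfl⟩ := h3
    -- One application to any letter produces the tower over `w`, and `N` more produce `u'`; the
    -- chosen letter is immaterial.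
    refine ⟨v, ⟨N + 1, (towerWord e w).head (towerWord_ne_nil
      (fun w => List.length_pos_iff.2 w.2.ne_nil) w), hv.trans ?_⟩, rfl⟩
    rw [← h1, pow_succ, letterImage_mul]
    exact infix_flatMap _ (towerWord_infix hp0 hmem w _)
  · have hadj : ∀ x ∈ (omega (towerSubst e τ parts)).carrier, ∀ i,
        TowerAdj (word := Subtype.val) e r l (x i) (x (i + 1)) := by
      intro x hx i
      obtain ⟨u', h1, -⟩ := hcover _ (hx i 2)
      have h2 := (towerAdj_of_word (e := e) (fun w => w.2.ne_nil) (fun w => w.2.head)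
        (fun w => w.2.last) (fun w => w.2.chain) u').infix h1
      simpa [factor] using h2
    exact TowerAdj.injective Subtype.val_injective (hadj x hx) (hadj y hy) hxy

end Main

end Substitutive

/-- The aperiodicity of `σ` is not used: return words to a two-letter word give the conjugacy
without recognizability. -/
theorem mainTheorem2 {A : Type*} [Fintype A] [DecidableEq A]
    [TopologicalSpace A] [DiscreteTopology A]
    (σ : Monoid.End (FreeMonoid A))
    (hsub : Substitutive.IsSubstitution σ)
    (hprim : Substitutive.IsPrimitive σ)
    (haper : Substitutive.IsAperiodic σ) :
    ∃ (m : ℕ) (ξ : Monoid.End (FreeMonoid (Fin m))),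
      Substitutive.IsSubstitution ξ ∧
      Substitutive.IsProper ξ ∧
      Substitutive.IsPrimitive ξ ∧
      Substitutive.Conjugate (Substitutive.omega σ) (Substitutive.omega ξ) ∧
      ∃ l : ℕ, 1 ≤ l ∧ ∀ μ : ℂ, μ ≠ 0 → μ ≠ 1 →
        (Substitutive.IsEigenvalue (Substitutive.incidenceMatrix σ ^ l) μ ↔
          Substitutive.IsEigenvalue (Substitutive.incidenceMatrix ξ) μ) := by
  open Substitutive in
  obtain ⟨k, r, l, f, g, hk, hS, hfin, hfull, C, hC0, hC, hρ⟩ := exists_setup hsub hprim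
  have : Fintype (ReturnWord (language σ) r l) := hfin.fintype
  obtain ⟨τ, hτ⟩ := hS.exists_derived
  have hmem := mem_derived hτ hfull
  have hlen : ∀ w : ReturnWord (language σ) r l, 0 < w.1.length :=
    fun w => List.length_pos_iff.2 w.2.ne_nil
  have hparts : ∀ w : ReturnWord (language σ) r l,
      ∃ p : Fin w.1.length → List (ReturnWord (language σ) r l),
        (∀ j, p j ≠ []) ∧ (List.ofFn p).flatten = τ w := fun w =>
    exists_nonempty_parts (hlen w) (length_le_length_derived hτ hC0 hC hρ w)
  choose parts hp0 hp using hparts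
  obtain ⟨w₁, h1⟩ := exists_head_derived hS hτ
  obtain ⟨w₂, h2⟩ := exists_getLast_derived hS hτ
  let e := Fintype.equivFin (Σ w : ReturnWord (language σ) r l, Fin w.1.length)
  have hproper : IsProper (towerSubst e τ parts) := isProper_towerSubst hlen hp0 h1 h2
  refine ⟨_, towerSubst e τ parts, isSubstitution_of_isLeftProper hproper.1
    (two_le_length_towerSubst hlen hp0 (two_le_length_derived hS hτ)), hproper,
    isPrimitive_towerSubst hp0 hmem, conjugate_towerSubst hsub hprim hk hS hτ hp hp0 hmem,
    -- The factor `k` comes from passing to `ρ`, the factor `2` from the towers carrying `τ²`.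
    k * 2, by omega, fun μ hμ0 hμ1 => ?_⟩
  rw [isEigenvalue_iff_hasEig, isEigenvalue_iff_hasEig, map_incidenceMatrix,
    hasEig_towerSubst hp hμ0, ← hS.hasEig_sq_iff hτ hμ0 hμ1, pow_mul, ← incidenceMatrix_pow,
    ← incidenceMatrix_pow, map_incidenceMatrix, pow_two, pow_two, ← countMatrix_flatMap]
  rw [show letterImage (σ ^ k * σ ^ k) = _ from funext fun b => letterImage_mul _ _ b]
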